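/- **Setting.** Let $\mathbb E$ be a space satisfying the axioms of absolute geometry. Its primitive notions are points, straight lines and planes (sets of points), the relation "$B$ lies between $A$ and $C$" on triples of distinct points of one line, and the congruence relations $\cong$ for segments and for angles. The axioms are: * *Incidence.* Each line contains at least two points; through two distinct points passes exactly one line; there are three points not on one line; through three points not on one line passes exactly one plane; each plane is non-empty; a line having two points in a plane lies in it; two distinct planes that intersect share at least two points; there are four points not on one plane. * *Order.* Betweenness is symmetric in its outer arguments; for $A\ne B$ there is $C$ with $B$ between $A$ and $C$; of three distinct points of a line at most one lies between the other two; Pasch's axiom. * *Congruence.* Congruence of segments is reflexive and transitive, a given segment can be laid off on a given ray from its origin in exactly one way, and sums and differences of congruent segments are congruent; congruence of angles is reflexive, a given angle can be laid off from a given ray into a given half-plane in exactly one way; if two triangles have two sides and the angle between them respectively congruent, then their other angles are also respectively congruent. * *Archimedes' axiom.* For any segments $[AB]$, $[OE]$ there are a positive integer $n$ and a segment $[CD]$ that is the sum of $n$ consecutive replicas of $[OE]$, such that $[AB]<[CD]$ (that is, $[AB]\cong[CF]$ for some $F$ between $C$ and $D$). * *Cantor's axiom.* If $[A_{n+1}B_{n+1}]\subset[A_nB_n]$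 for all $n$ for a sequence of segments on one line, then some point belongs to all of them. The parallel axiom is not assumed. Let $a$ be a line, let $O\neq E$ be points of $a$, and for $X,Y\in a$ write $X\prec Y$ if the vector $\overrightarrow{XY}$ is codirected with $\overrightarrow{OE}$. The translation of $a$ by a vector $\overrightarrow{XY}$ on $a$ is the mapping $a\to a$ that takes $X$ to $Y$, takes each segment to a congruent one and preserves $\prec$. Let $\mathbb D=\{k/2^m : k\in\mathbb Z,\ m\in\mathbb N\}$ be the set of binary-rational numbers. **Theorem.** 1. There is exactly one mapping $A:\mathbb D\to a$ such that $A(0)=O$, $A(1)=E$; for every integer $n\ge 0$, $A(n+1)$ is the image of $A(n)$ under the translation by $\overrightarrow{OE}$, and $A(-n-1)$ is the image of $A(-n)$ under the translation by $\overrightarrow{EO}$; and for all $k\in\mathbb Z$ and all integers $m\ge0$, $A\big(\tfrac{2k+1}{2^{m+1}}\big)$ is the center of the segment with ending points $A\big(\tfrac{k}{2^m}\big)$ and $A\big(\tfrac{k+1}{2^m}\big)$. 2. For this mapping, $p<q$ implies $A(p)\prec A(q)$ for all $p,q\in\mathbb D$. 3. The mapping $A$ extends to a bijective mapping $A:\mathbb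 R\to a$ such that $\xi<\eta$ implies $A(\xi)\prec A(\eta)$ for all $\xi,\eta\in\mathbb R$, and this extension is unique. In particular each $X\in a$ has exactly one coordinate, i.e. one real number $\xi$ with $X=A(\xi)$. -/

import Mathlib

universe u

/-- The primitive notions of Euclidean geometry on a set `P` of points. Straight lines and planes
are sets of points, betweenness is a ternary relation on points, and the two congruences are binary
relations between sets of points (used only for segments, resp. only for angles). -/
structure GeomData (P : Type u) where
  IsLine : Set P → Prop
  IsPlane : Set P → Prop
  /-- `Btw A B C`: the point `B` lies between `A` and `C`. -/
  Btw : P → P → P → Prop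
  segCongr : Set P → Set P → Prop
  angCongr : Set P → Set P → Prop

namespace GeomData

variable {P : Type u} (G : GeomData P)

/-- The three points lie on one straight line. -/
def Collinear (A B C : P) : Prop := ∃ a, G.IsLine a ∧ A ∈ a ∧ B ∈ a ∧ C ∈ a

/-- The segment `[AB]`. -/
def segment (A B : P) : Set P := {A} ∪ {B} ∪ {X | G.Btw A X B}

/-- Congruence `[AB] ≅ [CD]` of two (nondegenerate) segments. -/
def SegCong (A B C D : P) : Prop :=
  A ≠ B ∧ C ≠ D ∧ G.segCongr (G.segment A B) (G.segment C D)

/-- `[AB] < [CD]`: the interior of `[CD]` has a point `E` with `[AB] ≅ [CE]`. -/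
def SegLess (A B C D : P) : Prop := ∃ E, G.Btw C E D ∧ G.SegCong A B C E

/-- `[CD] ≅ n · [OE]`: the segment `[CD]` is the sum of `n` consecutive replicas of `[OE]`. -/
def IsMultiple (n : ℕ) (O E C D : P) : Prop :=
  ∃ S : ℕ → P, S 0 = C ∧ S n = D ∧
    (∀ i, i < n → G.SegCong (S i) (S (i + 1)) O E) ∧
    (∀ i, i + 2 ≤ n → G.Btw (S i) (S (i + 1)) (S (i + 2)))

/-- `M` is the center of the segment `[AB]`. -/
def IsCenter (A B M : P) : Prop := G.Btw A M B ∧ G.SegCong A M M B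

/-- `S 0, …, S (n - 1)` is a monotonic sequence of points. -/
def IsMonotonicSeq (n : ℕ) (S : ℕ → P) : Prop :=
  3 ≤ n ∧ ∀ i, i + 2 < n → G.Btw (S i) (S (i + 1)) (S (i + 2))

/-- The vectors `AB` and `CD` (lying on one straight line) are codirected. -/
def Codirected (A B C D : P) : Prop :=
  A ≠ B ∧ C ≠ D ∧ ∃ (n : ℕ) (S : ℕ → P), G.IsMonotonicSeq n S ∧
    ∃ i j k l : ℕ, i < n ∧ j < n ∧ k < n ∧ l < n ∧
      S i = A ∧ S j = B ∧ S k = C ∧ S l = D ∧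
      SignType.sign ((j : ℤ) - i) = SignType.sign ((l : ℤ) - k)

/-- `X ≺ Y` with respect to the direction given by the vector `MN`. -/
def Prec (M N X Y : P) : Prop := G.Codirected X Y M N

/-- The ray `[OE⟩`, i.e. `O` together with all `X` such that `O ≺ X` in the direction `OE`. -/
def ray (O E : P) : Set P := {O} ∪ {X | G.Prec O E O X}

/-- The open half-plane of the plane `α` cut off by the line `a` and containing the point `B`
(for `a ⊆ α` and `B ∈ α \ a`): the points off `a` joined with `B` by a segment missing `a`. -/
def openHalfPlane (α a : Set P) (B : P) : Set P :=
  {X | X ∈ α ∧ X ∉ a ∧ (X = B ∨ Disjoint (G.segment B X) a)}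

/-- The closed half-plane of the plane `α` cut off by the line `a` and containing `B`. -/
def closedHalfPlane (α a : Set P) (B : P) : Set P := G.openHalfPlane α a B ∪ a

/-- `H` is an open half-plane with boundary line `a`. -/
def IsOpenHalfPlane (H a : Set P) : Prop :=
  ∃ α B, G.IsPlane α ∧ G.IsLine a ∧ a ⊆ α ∧ B ∈ α ∧ B ∉ a ∧ H = G.openHalfPlane α a B

/-- The angle `∠AOB` (for `A`, `O`, `B` not on one line): the intersection of two closed
half-planes, the one of the line `OA` containing `B` and the one of the line `OB` containing `A`. -/
def angle (A O B : P) : Set P :=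
  {X | ∃ α a b, G.IsPlane α ∧ A ∈ α ∧ O ∈ α ∧ B ∈ α ∧
    G.IsLine a ∧ O ∈ a ∧ A ∈ a ∧ G.IsLine b ∧ O ∈ b ∧ B ∈ b ∧
    X ∈ G.closedHalfPlane α a B ∩ G.closedHalfPlane α b A}

/-- Congruence `∠ABC ≅ ∠DEF` of two angles. -/
def AngCong (A B C D E F : P) : Prop :=
  ¬ G.Collinear A B C ∧ ¬ G.Collinear D E F ∧ G.angCongr (G.angle A B C) (G.angle D E F)

/-- Axioms of absolute geometry: incidence, order, congruence, and continuity
(all of Euclid's axioms except for the axiom of parallels). -/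
structure IsAbsoluteGeometry : Prop where
  -- incidence
  line_two_points : ∀ a, G.IsLine a → ∃ A ∈ a, ∃ B ∈ a, A ≠ B
  line_through : ∀ A B, A ≠ B → ∃! a, G.IsLine a ∧ A ∈ a ∧ B ∈ a
  exists_noncollinear : ∃ A B C, A ≠ B ∧ A ≠ C ∧ B ≠ C ∧ ¬ G.Collinear A B C
  plane_through : ∀ A B C, ¬ G.Collinear A B C → ∃! α, G.IsPlane α ∧ A ∈ α ∧ B ∈ α ∧ C ∈ α
  plane_nonempty : ∀ α, G.IsPlane α → α.Nonempty
  line_subset_plane : ∀ a α A B, G.IsLine a → G.IsPlane α → A ≠ B →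
    A ∈ a → B ∈ a → A ∈ α → B ∈ α → a ⊆ α
  planes_inter : ∀ α β, G.IsPlane α → G.IsPlane β → α ≠ β → (α ∩ β).Nonempty →
    ∃ A ∈ α ∩ β, ∃ B ∈ α ∩ β, A ≠ B
  exists_noncoplanar : ∃ A B C D, A ≠ B ∧ A ≠ C ∧ A ≠ D ∧ B ≠ C ∧ B ≠ D ∧ C ≠ D ∧
    ¬ ∃ α, G.IsPlane α ∧ A ∈ α ∧ B ∈ α ∧ C ∈ α ∧ D ∈ α
  -- order; the first item is the convention that betweenness is a relation
  -- between distinct points of one straight line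
  btw_dom : ∀ A B C, G.Btw A B C → A ≠ B ∧ B ≠ C ∧ A ≠ C ∧ G.Collinear A B C
  btw_symm : ∀ A B C, G.Btw A B C → G.Btw C B A
  btw_extend : ∀ A B, A ≠ B → ∃ C, G.Btw A B C
  btw_unique : ∀ A B C, A ≠ B → B ≠ C → A ≠ C → G.Collinear A B C →
    ¬ (G.Btw A B C ∧ G.Btw B C A) ∧ ¬ (G.Btw B C A ∧ G.Btw C A B) ∧
    ¬ (G.Btw C A B ∧ G.Btw A B C)
  pasch : ∀ α a A B C, G.IsPlane α → A ∈ α → B ∈ α → C ∈ α → ¬ G.Collinear A B C →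
    G.IsLine a → a ⊆ α → A ∉ a → B ∉ a → C ∉ a →
    (∃ X ∈ a, G.Btw A X B) → (∃ X ∈ a, G.Btw A X C) ∨ (∃ X ∈ a, G.Btw B X C)
  -- congruence
  seg_refl : ∀ A B, A ≠ B → G.SegCong A B A B
  seg_construct : ∀ A B C X, A ≠ B → C ≠ X → ∃! D, D ∈ G.ray C X ∧ G.SegCong A B C D
  seg_trans : ∀ A B C D E F, G.SegCong A B C D → G.SegCong C D E F → G.SegCong A B E F
  seg_add : ∀ A B C K L M, G.Btw A B C → G.Btw K L M →
    G.SegCong A B K L → G.SegCong B C L M → G.SegCong A C K M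
  seg_sub : ∀ A B C K L M, G.Btw A B C → G.Btw K L M →
    G.SegCong A B K L → G.SegCong A C K M → G.SegCong B C L M
  ang_refl : ∀ A O B, ¬ G.Collinear A O B → G.AngCong A O B A O B
  ang_construct : ∀ A O B H a Q M, ¬ G.Collinear A O B → G.IsOpenHalfPlane H a →
    Q ∈ a → M ∈ a → Q ≠ M →
    ∃! n : Set P, ∃ N ∈ H, n = G.ray Q N ∧ G.AngCong A O B M Q N
  sas : ∀ A B C A' B' C', ¬ G.Collinear A B C → ¬ G.Collinear A' B' C' →
    G.SegCong A B A' B' → G.SegCong A C A' C' → G.AngCong B A C B' A' C' →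
    G.AngCong A B C A' B' C' ∧ G.AngCong A C B A' C' B'
  -- continuity
  archimedes : ∀ A B O E, A ≠ B → O ≠ E →
    ∃ n : ℕ, 0 < n ∧ ∃ C D, G.IsMultiple n O E C D ∧ G.SegLess A B C D
  cantor : ∀ a (A B : ℕ → P), G.IsLine a → (∀ n, A n ∈ a ∧ B n ∈ a ∧ A n ≠ B n) →
    (∀ n, G.segment (A (n + 1)) (B (n + 1)) ⊆ G.segment (A n) (B n)) →
    ∃ X, ∀ n, X ∈ G.segment (A n) (B n)

/-- `f` is the congruent translation of the line `a` along itself that takes `X` to `Y` and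
preserves precedence (precedence being taken in the direction `MN`, on `a`): the translation
by the vector `XY`. -/
def IsTranslation (a : Set P) (M N X Y : P) (f : a → a) : Prop :=
  (∀ U V : a, U ≠ V → G.SegCong (f U) (f V) U V) ∧
  (∀ U V : a, G.Prec M N U V → G.Prec M N (f U) (f V)) ∧
  ∀ U : a, (U : P) = X → (f U : P) = Y

end GeomData

/-- The binary-rational numbers `k / 2 ^ m`. -/
def binaryRationals : Set ℝ := {r | ∃ (k : ℤ) (m : ℕ), r = k / 2 ^ m}

/-- The binary-rational number `k / 2 ^ m`. -/
noncomputable def binRat (k : ℤ) (m : ℕ) : binaryRationals := ⟨k / 2 ^ m, k, m, rfl⟩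

/-- `A : 𝔻 → a` is the enumeration of points of the line `a` by binary-rational numbers obtained
from the segment `[OE]`: the integer points arise from `A(0) = O` by repeated translation by the
vector `OE` and by the opposite vector `EO`, the others by repeated bisection of the segments
connecting neighboring points. -/
structure GeomData.IsBinaryGauge {P : Type u} (G : GeomData P) (a : Set P) (O E : P)
    (A : binaryRationals → a) : Prop where
  zero : (A (binRat 0 0) : P) = O
  one : (A (binRat 1 0) : P) = E
  forward : ∃ p : a → a, G.IsTranslation a O E O E p ∧
    ∀ n : ℕ, A (binRat (n + 1) 0) = p (A (binRat n 0))
  backward : ∃ q : a → a, G.IsTranslation a O E E O q ∧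
    ∀ n : ℕ, A (binRat (-(n + 1)) 0) = q (A (binRat (-n) 0))
  bisect : ∀ (m : ℕ) (k : ℤ),
    G.IsCenter (A (binRat k m)) (A (binRat (k + 1) m)) (A (binRat (2 * k + 1) (m + 1)))

/-! The line carries a ruler: a bijection `φ : a ≃ ℝ` with `φ O = 0`, `φ E = 1` that turns
precedence into `<`, betweenness into betweenness of reals, and congruence into equality of
distances (`exists_ruler`). In this coordinate the translations are shifts and centers are
arithmetic means, so a binary gauge must send `r` to the point with coordinate `r`, and `φ.symm`
does so. An increasing extension to `ℝ` composed with `φ` is increasing and fixes a dense set, hence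
is the identity.

The ruler is built as follows. Pasch's axiom yields the order theorems for points of a line, which
make `a` a linear order in which codirected vectors are those pointing the same way. Laying off
segments defines equality of vectors on `a`; the rule `vecEq_parallelogram` makes addition of
position vectors commutative, so `a` is an ordered abelian group. Archimedes' axiom makes this group
Archimedean, and Hölder's theorem embeds it in `ℝ`. A point between any two points makes the image
dense, and Cantor's axiom makes it everything. -/

namespace GeomData

/-! ### Incidence, and order on a line from Pasch's axiom -/

namespace IsAbsoluteGeometry

variable {P : Type u} {G : GeomData P} (hG : G.IsAbsoluteGeometry)
include hG

theorem line_eq {l m : Set P} {A B : P} (hl : G.IsLine l) (hm : G.IsLine m) (hAB : A ≠ B)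
    (hAl : A ∈ l) (hBl : B ∈ l) (hAm : A ∈ m) (hBm : B ∈ m) : l = m :=
  (hG.line_through A B hAB).unique ⟨hl, hAl, hBl⟩ ⟨hm, hAm, hBm⟩

theorem exists_line {A B : P} (hAB : A ≠ B) : ∃ l, G.IsLine l ∧ A ∈ l ∧ B ∈ l :=
  (hG.line_through A B hAB).exists

theorem btw_mem_right {l : Set P} {A B C : P} (h : G.Btw A B C) (hl : G.IsLine l)
    (hA : A ∈ l) (hB : B ∈ l) : C ∈ l := by
  obtain ⟨hAB, -, -, m, hm, hAm, hBm, hCm⟩ := hG.btw_dom A B C h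
  rwa [hG.line_eq hl hm hAB hA hB hAm hBm]

theorem btw_mem_mid {l : Set P} {A B C : P} (h : G.Btw A B C) (hl : G.IsLine l)
    (hA : A ∈ l) (hC : C ∈ l) : B ∈ l := by
  obtain ⟨-, -, hAC, m, hm, hAm, hBm, hCm⟩ := hG.btw_dom A B C h
  rwa [hG.line_eq hl hm hAC hA hC hAm hCm]

theorem btw_ne {A B C : P} (h : G.Btw A B C) : A ≠ B ∧ B ≠ C ∧ A ≠ C :=
  ⟨(hG.btw_dom A B C h).1, (hG.btw_dom A B C h).2.1, (hG.btw_dom A B C h).2.2.1⟩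

theorem not_btw_of_btw {A B C : P} (h : G.Btw A B C) : ¬ G.Btw A C B ∧ ¬ G.Btw B A C := by
  obtain ⟨hAB, hBC, hAC, hcol⟩ := hG.btw_dom A B C h
  obtain ⟨h1, -, h3⟩ := hG.btw_unique A B C hAB hBC hAC hcol
  exact ⟨fun h' => h1 ⟨h, hG.btw_symm _ _ _ h'⟩, fun h' => h3 ⟨hG.btw_symm _ _ _ h', h⟩⟩

/-- Every line lies, together with some point off it, in a plane. -/
theorem exists_off_line {l : Set P} (hl : G.IsLine l) :
    ∃ α E, G.IsPlane α ∧ l ⊆ α ∧ E ∈ α ∧ E ∉ l := by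
  obtain ⟨E, hE⟩ : ∃ E, E ∉ l := by
    obtain ⟨A, B, C, -, -, -, h⟩ := hG.exists_noncollinear
    by_contra! hall
    exact h ⟨l, hl, hall A, hall B, hall C⟩
  obtain ⟨A, hA, B, hB, hAB⟩ := hG.line_two_points l hl
  have hcol : ¬ G.Collinear A B E := by
    rintro ⟨m, hm, hAm, hBm, hEm⟩
    exact hE (hG.line_eq hl hm hAB hA hB hAm hBm ▸ hEm)
  obtain ⟨α, hα, hAα, hBα, hEα⟩ := (hG.plane_through A B E hcol).exists
  exact ⟨α, E, hα, hG.line_subset_plane l α A B hl hα hAB hA hB hAα hBα, hEα, hE⟩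

/-- A line in a plane through two of its points. -/
theorem exists_line_subset {α : Set P} (hα : G.IsPlane α) {A B : P} (hA : A ∈ α) (hB : B ∈ α)
    (hAB : A ≠ B) : ∃ l, G.IsLine l ∧ A ∈ l ∧ B ∈ l ∧ l ⊆ α := by
  obtain ⟨l, hl, hAl, hBl⟩ := hG.exists_line hAB
  exact ⟨l, hl, hAl, hBl, hG.line_subset_plane l α A B hl hα hAB hAl hBl hA hB⟩

/-- Pasch's axiom for the triangle `ABC` whose side `AB` lies on the line `m`, and the line `l`
crossing that side at `Q`. -/
theorem pasch_line {α l m : Set P} {A B C Q : P} (hα : G.IsPlane α) (hl : G.IsLine l)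
    (hlα : l ⊆ α) (hm : G.IsLine m) (hmα : m ⊆ α) (hC : C ∈ α) (hAm : A ∈ m) (hBm : B ∈ m)
    (hCm : C ∉ m) (hCl : C ∉ l) (hlm : l ≠ m) (hQ : Q ∈ l) (hbtw : G.Btw A Q B) :
    (∃ X ∈ l, G.Btw A X C) ∨ ∃ X ∈ l, G.Btw B X C := by
  obtain ⟨hAQ, hQB, hAB⟩ := hG.btw_ne hbtw
  have hQm := hG.btw_mem_mid hbtw hm hAm hBm
  refine hG.pasch α l A B C hα (hmα hAm) (hmα hBm) hC ?_ hl hlα ?_ ?_ hCl ⟨Q, hQ, hbtw⟩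
  · rintro ⟨k, hk, hAk, hBk, hCk⟩
    exact hCm (hG.line_eq hm hk hAB hAm hBm hAk hBk ▸ hCk)
  · exact fun h => hlm (hG.line_eq hl hm hAQ h hQ hAm hQm)
  · exact fun h => hlm (hG.line_eq hl hm hQB hQ h hQm hBm)

/-- With `E` off the line, `F` beyond `E` on `AE` and `Q` beyond `C` on `FC`, the line `EQ` enters
the triangle `AFC` through `AF`. It meets the line `FC` only at `Q`, outside the side, so it leaves
through `AC`. -/
theorem exists_btw {A C : P} (hAC : A ≠ C) : ∃ B, G.Btw A B C := by
  have key := @hG.line_eq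
  have bne := @hG.btw_ne
  have bnot := @hG.not_btw_of_btw
  obtain ⟨m, hm, hAm, hCm⟩ := hG.exists_line hAC
  obtain ⟨α, E, hα, hmα, hEα, hEm⟩ := hG.exists_off_line hm
  have hAE : A ≠ E := by grind
  obtain ⟨F, hF⟩ := hG.btw_extend A E hAE
  obtain ⟨l₁, hl₁, hA1, hE1, hl₁α⟩ := hG.exists_line_subset hα (hmα hAm) hEα hAE
  have hF1 := hG.btw_mem_right hF hl₁ hA1 hE1
  have hC1 : C ∉ l₁ := fun h => hEm (key hl₁ hm hAC hA1 h hAm hCm ▸ hE1)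
  have hFC : F ≠ C := by grind
  obtain ⟨l₂, hl₂, hF2, hC2, hl₂α⟩ := hG.exists_line_subset hα (hl₁α hF1) (hmα hCm) hFC
  obtain ⟨Q, hQ⟩ := hG.btw_extend F C hFC
  have hQ2 := hG.btw_mem_right hQ hl₂ hF2 hC2
  have hE2 : E ∉ l₂ := fun h => hC1 (key hl₁ hl₂ (bne hF).2.1 hE1 hF1 h hF2 ▸ hC2)
  have hEQ : E ≠ Q := by grind
  obtain ⟨l₃, hl₃, hE3, hQ3, hl₃α⟩ := hG.exists_line_subset hα hEα (hl₂α hQ2) hEQ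
  have h32 : l₃ ≠ l₂ := by grind
  have h31 : l₃ ≠ l₁ := by
    rintro rfl
    exact hE2 (key hl₃ hl₂ (bne hQ).2.2 hF1 hQ3 hF2 hQ2 ▸ hE3)
  have hC3 : C ∉ l₃ := fun h => h32 (key hl₃ hl₂ (bne hQ).2.1 h hQ3 hC2 hQ2)
  rcases hG.pasch_line hα hl₃ hl₃α hl₁ hl₁α (hmα hCm) hA1 hF1 hC1 hC3 h31 hE3 hF with
    ⟨X, -, hX⟩ | ⟨X, hX3, hX⟩
  · exact ⟨X, hX⟩
  · have hX2 := hG.btw_mem_mid hX hl₂ hF2 hC2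
    have hXQ : X ≠ Q := by grind
    exact absurd (key hl₃ hl₂ hXQ hX3 hQ3 hX2 hQ2) h32

/-- Suppose no point is between the others. With `D` off the line and `Q` beyond `D` on `BD`,
Pasch's axiom makes `AD` meet `QC` at some `E` and `CD` meet `QA` at some `F`. Applied to the
triangle `QAE` it puts `D` between `A` and `E`; applied to `AEC` it then puts `B` between `A` and
`C`. -/
theorem btw_trichotomy {m : Set P} (hm : G.IsLine m) {A B C : P} (hA : A ∈ m) (hB : B ∈ m)
    (hC : C ∈ m) (hAB : A ≠ B) (hBC : B ≠ C) (hAC : A ≠ C) :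
    G.Btw A B C ∨ G.Btw B A C ∨ G.Btw A C B := by
  have key := @hG.line_eq
  have bne := @hG.btw_ne
  have bnot := @hG.not_btw_of_btw
  have bsymm := hG.btw_symm
  have bmid := @hG.btw_mem_mid
  by_contra! hcon
  obtain ⟨hABC, hBAC, hACB⟩ := hcon
  obtain ⟨α, D, hα, hmα, hDα, hDm⟩ := hG.exists_off_line hm
  have hBD : B ≠ D := by grind
  obtain ⟨Q, hQ⟩ := hG.btw_extend B D hBD
  obtain ⟨b, hb, hBb, hDb, hbα⟩ := hG.exists_line_subset hα (hmα hB) hDα hBD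
  have hQb := hG.btw_mem_right hQ hb hBb hDb
  have hAb : A ∉ b := fun h => hDm (key hb hm hAB h hBb hA hB ▸ hDb)
  have hCb : C ∉ b := fun h => hDm (key hb hm hBC hBb h hB hC ▸ hDb)
  have hQm : Q ∉ m := fun h => hDm (key hb hm (bne hQ).2.2 hBb hQb hB h ▸ hDb)
  have hAD : A ≠ D := by grind
  have hCD : C ≠ D := by grind
  have hCQ : C ≠ Q := by grind
  have hAQ : A ≠ Q := by grind
  obtain ⟨p, hp, hAp, hDp, hpα⟩ := hG.exists_line_subset hα (hmα hA) hDα hAD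
  obtain ⟨r, hr, hCr, hDr, hrα⟩ := hG.exists_line_subset hα (hmα hC) hDα hCD
  obtain ⟨s, hs, hCs, hQs, hsα⟩ := hG.exists_line_subset hα (hmα hC) (hbα hQb) hCQ
  obtain ⟨t, ht, hAt, hQt, htα⟩ := hG.exists_line_subset hα (hmα hA) (hbα hQb) hAQ
  have hCp : C ∉ p := fun h => hDm (key hp hm hAC hAp h hA hC ▸ hDp)
  have hAr : A ∉ r := fun h => hDm (key hr hm hAC h hCr hA hC ▸ hDr)
  have hpb : p ≠ b := by grind
  have hrb : r ≠ b := by grind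
  have hDs : D ∉ s := fun h => hCb (key hs hb (bne hQ).2.1 h hQs hDb hQb ▸ hCs)
  have hDt : D ∉ t := fun h => hAb (key ht hb (bne hQ).2.1 h hQt hDb hQb ▸ hAt)
  have hAs : A ∉ s := fun h => hQm (key hs hm hAC h hCs hA hC ▸ hQs)
  have hpm : p ≠ m := by grind
  have hrm : r ≠ m := by grind
  obtain ⟨E, hEp, hE⟩ : ∃ X ∈ p, G.Btw Q X C := by
    rcases hG.pasch_line hα hp hpα hb hbα (hmα hC) hBb hQb hCb hCp hpb hDp hQ with
      ⟨X, hXp, hX⟩ | h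
    · have := bmid hX hm hB hC
      have hXA : X = A := by
        by_contra hne
        exact hpm (key hp hm hne hXp hAp this hA)
      exact absurd (hXA ▸ hX) hBAC
    · exact h
  obtain ⟨F, hFr, hF⟩ : ∃ X ∈ r, G.Btw Q X A := by
    rcases hG.pasch_line hα hr hrα hb hbα (hmα hA) hBb hQb hAb hAr hrb hDr hQ with
      ⟨X, hXr, hX⟩ | h
    · have := bmid hX hm hB hA
      have hXC : X = C := by
        by_contra hne
        exact hrm (key hr hm hne hXr hCr this hC)
      exact absurd (bsymm _ _ _ (hXC ▸ hX)) hACB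
    · exact h
  have hEs := bmid hE hs hQs hCs
  have hFt := bmid hF ht hQt hAt
  have hEt : E ∉ t := fun h => by
    have := key hs ht (bne hE).1 hQs hEs hQt h
    exact hAs (this ▸ hAt)
  have hrs : r ≠ s := by grind
  have hEr : E ∉ r := fun h => hrs (key hr hs (bne hE).2.1 h hCr hEs hCs)
  have hrt : r ≠ t := by grind
  have hADE : G.Btw A D E := by
    rcases hG.pasch_line hα hr hrα ht htα (hpα hEp) hQt hAt hEt hEr hrt hFr hF with
      ⟨X, hXr, hX⟩ | ⟨X, hXr, hX⟩
    · have hXs := bmid hX hs hQs hEs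
      have hXC : X = C := by
        by_contra hne
        exact hrs (key hr hs hne hXr hCr hXs hCs)
      exact absurd (hXC ▸ hX) (bnot hE).1
    · have hXp := bmid hX hp hAp hEp
      have hXD : X = D := by
        by_contra hne
        have : r = p := key hr hp hne hXr hDr hXp hDp
        exact hAr (this ▸ hAp)
      exact hXD ▸ hX
  have hbp : b ≠ p := hpb.symm
  have hbs : b ≠ s := by grind
  rcases hG.pasch_line hα hb hbα hp hpα (hmα hC) hAp hEp hCp hCb hbp hDb hADE with
    ⟨X, hXb, hX⟩ | ⟨X, hXb, hX⟩
  · have hXm := bmid hX hm hA hC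
    have hXB : X = B := by
      by_contra hne
      have : b = m := key hb hm hne hXb hBb hXm hB
      exact hAb (this ▸ hA)
    exact hABC (hXB ▸ hX)
  · have hXs := bmid hX hs hEs hCs
    have hXQ : X = Q := by
      by_contra hne
      exact hbs (key hb hs hne hXb hQb hXs hQs)
    exact (bnot hE).2 (hXQ ▸ hX)

theorem btw_of_btw_of_btw_mid {A B C D : P} (h₁ : G.Btw A B C) (h₂ : G.Btw B C D) :
    G.Btw A C D := by
  have key := @hG.line_eq
  have bne := @hG.btw_ne
  have bnot := @hG.not_btw_of_btw
  have bsymm := hG.btw_symm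
  have bmid := @hG.btw_mem_mid
  obtain ⟨m, hm, hA, hB⟩ := hG.exists_line (bne h₁).1
  have hC := hG.btw_mem_right h₁ hm hA hB
  have hD := hG.btw_mem_right h₂ hm hB hC
  by_cases hAD : A = D
  · subst hAD
    exact absurd (bsymm _ _ _ h₂) (bnot h₁).1
  obtain ⟨α, E, hα, hmα, hEα, hEm⟩ := hG.exists_off_line hm
  have hCE : C ≠ E := by grind
  have hAE : A ≠ E := by grind
  obtain ⟨F, hF⟩ := hG.btw_extend C E hCE
  obtain ⟨c, hc, hCc, hEc, hcα⟩ := hG.exists_line_subset hα (hmα hC) hEα hCE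
  obtain ⟨p, hp, hAp, hEp, hpα⟩ := hG.exists_line_subset hα (hmα hA) hEα hAE
  have hFc := hG.btw_mem_right hF hc hCc hEc
  have hcm : c ≠ m := by grind
  have hpm : p ≠ m := by grind
  have hFm : F ∉ m := fun h => hcm (key hc hm (bne hF).2.2 hCc hFc hC h)
  have hBF : B ≠ F := by grind
  obtain ⟨b, hb, hBb, hFb, hbα⟩ := hG.exists_line_subset hα (hmα hB) (hcα hFc) hBF
  have hbm : b ≠ m := by grind
  have inter : ∀ {k X Y}, G.IsLine k → k ≠ m → X ∈ k → Y ∈ k → X ∈ m → Y ∈ m → X = Y := by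
    intro k X Y hk hkm hX hY hXm hYm
    by_contra hne
    exact hkm (key hk hm hne hX hY hXm hYm)
  have hAc : A ∉ c := fun h => (bne h₁).2.2 (inter hc hcm h hCc hA hC)
  have hBc : B ∉ c := fun h => (bne h₁).2.1 (inter hc hcm h hCc hB hC)
  have hDc : D ∉ c := fun h => (bne h₂).2.1 (inter hc hcm hCc h hC hD)
  have hAb : A ∉ b := fun h => (bne h₁).1 (inter hb hbm h hBb hA hB)
  have hCb : C ∉ b := fun h => (bne h₁).2.1 (inter hb hbm hBb h hB hC)
  have hDb : D ∉ b := fun h => (bne h₂).2.2 (inter hb hbm hBb h hB hD)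
  have hBp : B ∉ p := fun h => (bne h₁).1 (inter hp hpm hAp h hA hB)
  have hCp : C ∉ p := fun h => (bne h₁).2.2 (inter hp hpm hAp h hA hC)
  have hDp : D ∉ p := fun h => hAD (inter hp hpm hAp h hA hD)
  have hcb : c ≠ b := by grind
  have hcp : c ≠ p := by grind
  have hbp : b ≠ p := by grind
  have hEb : E ∉ b := fun h => hcb (key hc hb (bne hF).2.1 hEc hFc h hFb)
  -- The line `BF` cuts `AE` at `Q`, with `Q` between `B` and `F`. So `CE` misses the side `BQ` and
  -- must cut `DQ`; as it misses `AQ`, it cuts `AD`, necessarily at `C`.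
  obtain ⟨Q, hQb, hQ⟩ : ∃ X ∈ b, G.Btw A X E := by
    rcases hG.pasch_line hα hb hbα hm hmα hEα hA hC hEm hEb hbm hBb h₁ with
      h | ⟨X, hXb, hX⟩
    · exact h
    · have hXc := bmid hX hc hCc hEc
      have hXF : X = F := by
        by_contra hne
        exact hcb (key hc hb hne hXc hFc hXb hFb)
      exact absurd (hXF ▸ hX) (bnot hF).1
  have hQp := bmid hQ hp hAp hEp
  have hBQF : G.Btw B Q F := by
    rcases hG.pasch_line hα hp hpα hc hcα (hmα hB) hCc hFc hBc hBp hcp.symm hEp hF with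
      ⟨X, hXp, hX⟩ | ⟨X, hXp, hX⟩
    · have hXm := bmid hX hm hC hB
      have hXA := inter hp hpm hXp hAp hXm hA
      exact absurd (bsymm _ _ _ (hXA ▸ hX)) (bnot h₁).2
    · have hXb := bmid hX hb hFb hBb
      have hXQ : X = Q := by
        by_contra hne
        exact hbp (key hb hp hne hXb hQb hXp hQp)
      exact bsymm _ _ _ (hXQ ▸ hX)
  have hQc : Q ∉ c := fun h => hcp (key hc hp (bne hQ).2.1 h hEc hQp hEp)
  have hQm : Q ∉ m := fun h => hbm (key hb hm (bne hBQF).1 hBb hQb hB h)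
  obtain ⟨H, hHc, hH⟩ : ∃ X ∈ c, G.Btw D X Q := by
    rcases hG.pasch_line hα hc hcα hm hmα (hbα hQb) hB hD hQm hQc hcm hCc h₂ with
      ⟨X, hXc, hX⟩ | h
    · have hXb := bmid hX hb hBb hQb
      have hXF : X = F := by
        by_contra hne
        exact hcb (key hc hb hne hXc hFc hXb hFb)
      exact absurd (hXF ▸ hX) (bnot hBQF).1
    · exact h
  have hDQ : D ≠ Q := by grind
  obtain ⟨d, hd, hDd, hQd, hdα⟩ := hG.exists_line_subset hα (hmα hD) (hbα hQb) hDQ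
  have hdm : d ≠ m := by grind
  have hAd : A ∉ d := fun h => hAD (inter hd hdm h hDd hA hD)
  have hcd : c ≠ d := by grind
  rcases hG.pasch_line hα hc hcα hd hdα (hmα hA) hDd hQd hAd hAc hcd hHc hH with
    ⟨X, hXc, hX⟩ | ⟨X, hXc, hX⟩
  · have hXm := bmid hX hm hD hA
    have hXC := inter hc hcm hXc hCc hXm hC
    exact bsymm _ _ _ (hXC ▸ hX)
  · have hXp := bmid hX hp hQp hAp
    have hXE : X = E := by
      by_contra hne
      exact hcp (key hc hp hne hXc hEc hXp hEp)
    exact absurd (bsymm _ _ _ (hXE ▸ hX)) (bnot hQ).1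

theorem btw_of_btw_of_btw_left {A B C D : P} (h₁ : G.Btw A B C) (h₂ : G.Btw A C D) :
    G.Btw B C D := by
  have key := @hG.line_eq
  have bne := @hG.btw_ne
  have bnot := @hG.not_btw_of_btw
  have bsymm := hG.btw_symm
  have bmid := @hG.btw_mem_mid
  obtain ⟨m, hm, hA, hB⟩ := hG.exists_line (bne h₁).1
  have hC := hG.btw_mem_right h₁ hm hA hB
  have hD := hG.btw_mem_right h₂ hm hA hC
  obtain ⟨α, Q, hα, hmα, hQα, hQm⟩ := hG.exists_off_line hm
  have hBQ : B ≠ Q := by grind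
  have hAQ : A ≠ Q := by grind
  obtain ⟨F, hF⟩ := hG.btw_extend B Q hBQ
  obtain ⟨b, hb, hBb, hQb, hbα⟩ := hG.exists_line_subset hα (hmα hB) hQα hBQ
  obtain ⟨p, hp, hAp, hQp, hpα⟩ := hG.exists_line_subset hα (hmα hA) hQα hAQ
  have hFb := hG.btw_mem_right hF hb hBb hQb
  have hbm : b ≠ m := by grind
  have hpm : p ≠ m := by grind
  have hFm : F ∉ m := fun h => hbm (key hb hm (bne hF).2.2 hBb hFb hB h)
  have hCF : C ≠ F := by grind
  obtain ⟨c, hc, hCc, hFc, hcα⟩ := hG.exists_line_subset hα (hmα hC) (hbα hFb) hCF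
  have hcm : c ≠ m := by grind
  have inter : ∀ {k X Y}, G.IsLine k → k ≠ m → X ∈ k → Y ∈ k → X ∈ m → Y ∈ m → X = Y := by
    intro k X Y hk hkm hX hY hXm hYm
    by_contra hne
    exact hkm (key hk hm hne hX hY hXm hYm)
  have hAc : A ∉ c := fun h => (bne h₁).2.2 (inter hc hcm h hCc hA hC)
  have hBc : B ∉ c := fun h => (bne h₁).2.1 (inter hc hcm h hCc hB hC)
  have hDc : D ∉ c := fun h => (bne h₂).2.1 (inter hc hcm hCc h hC hD)
  have hBp : B ∉ p := fun h => (bne h₁).1 (inter hp hpm hAp h hA hB)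
  have hcb : c ≠ b := by grind
  have hcp : c ≠ p := by
    rintro rfl
    exact hAc hAp
  have hQc : Q ∉ c := fun h => hcb (key hc hb (bne hF).2.1 h hFc hQb hFb)
  -- The line `c = CF` misses the sides `QB` and `AQ`, so by Pasch's axiom it leaves `ADQ` through
  -- `DQ` and then `DQB` through `DB`, at `C`.
  have hBQ' : ∀ X ∈ c, ¬ G.Btw Q X B := by
    intro X hXc hX
    have hXb := bmid hX hb hQb hBb
    have hXF : X = F := by
      by_contra hne
      exact hcb (key hc hb hne hXc hFc hXb hFb)
    exact absurd (bsymm _ _ _ (hXF ▸ hX)) (bnot hF).1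
  have hAQ' : ∀ X ∈ c, ¬ G.Btw A X Q := by
    intro X hXc hX
    rcases hG.pasch_line hα hc hcα hp hpα (hmα hB) hAp hQp hBp hBc hcp hXc hX with
      ⟨Y, hYc, hY⟩ | ⟨Y, hYc, hY⟩
    · have hYC := inter hc hcm hYc hCc (bmid hY hm hA hB) hC
      exact absurd (hYC ▸ hY) (bnot h₁).1
    · exact hBQ' Y hYc hY
  obtain ⟨H, hHc, hH⟩ : ∃ X ∈ c, G.Btw D X Q := by
    rcases hG.pasch_line hα hc hcα hm hmα hQα hA hD hQm hQc hcm hCc h₂ with ⟨X, hXc, hX⟩ | h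
    · exact absurd hX (hAQ' X hXc)
    · exact h
  have hDQ : D ≠ Q := by grind
  obtain ⟨d, hd, hDd, hQd, hdα⟩ := hG.exists_line_subset hα (hmα hD) hQα hDQ
  have hdm : d ≠ m := by grind
  have hBD : B ≠ D := by
    rintro rfl
    exact absurd h₂ (bnot h₁).1
  have hBd : B ∉ d := fun h => hBD (inter hd hdm h hDd hB hD)
  have hcd : c ≠ d := by grind
  rcases hG.pasch_line hα hc hcα hd hdα (hmα hB) hDd hQd hBd hBc hcd hHc hH with
    ⟨X, hXc, hX⟩ | ⟨X, hXc, hX⟩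
  · have hXC := inter hc hcm hXc hCc (bmid hX hm hD hB) hC
    exact bsymm _ _ _ (hXC ▸ hX)
  · exact absurd hX (hBQ' X hXc)

end IsAbsoluteGeometry
end GeomData

/-! ### The linear order of a line -/

/-- A ternary relation satisfying the order axioms of a line is the betweenness relation of a linear
order, and the direction of the order may be prescribed. -/
theorem exists_linearOrder_of_betweenness {T : Type u} (B : T → T → T → Prop)
    (hne : ∀ X Y Z, B X Y Z → X ≠ Y ∧ Y ≠ Z ∧ X ≠ Z) (hsymm : ∀ X Y Z, B X Y Z → B Z Y X)
    (hnot : ∀ X Y Z, B X Y Z → ¬ B X Z Y)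
    (htri : ∀ X Y Z, X ≠ Y → Y ≠ Z → X ≠ Z → B X Y Z ∨ B Y X Z ∨ B X Z Y)
    (hmid : ∀ X Y Z W, B X Y Z → B Y Z W → B X Z W)
    (hleft : ∀ X Y Z W, B X Y Z → B X Z W → B Y Z W) {O E : T} (hOE : O ≠ E) :
    ∃ _ : LinearOrder T, O < E ∧
      ∀ X Y Z, B X Y Z ↔ (X < Y ∧ Y < Z) ∨ (Z < Y ∧ Y < X) := by
  classical
  have hleft' : ∀ X Y Z W, B X Y Z → B X Z W → B X Y W := fun X Y Z W h h' =>
    hsymm _ _ _ (hmid _ _ _ _ (hsymm _ _ _ (hleft _ _ _ _ h h')) (hsymm _ _ _ h))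
  -- Call `X` negative if `O` lies between `X` and `E`. These three facts say that `O` separates
  -- negative points from the others, and only those.
  have opp : ∀ X Y, B X O E → Y ≠ O → ¬ B Y O E → B X O Y := by
    intro X Y hX hY hYE
    by_cases hYeq : Y = E
    · exact hYeq ▸ hX
    rcases htri O Y E hY.symm hYeq hOE with h | h | h
    · exact hsymm _ _ _ (hleft _ _ _ _ (hsymm _ _ _ h) (hsymm _ _ _ hX))
    · exact absurd h hYE
    · exact hsymm _ _ _ (hmid _ _ _ _ (hsymm _ _ _ h) (hsymm _ _ _ hX))
  have samePos : ∀ X Y, ¬ B X O E → ¬ B Y O E → ¬ B X O Y := by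
    intro X Y hX hY h
    have hYO : Y ≠ O := (hne _ _ _ h).2.1.symm
    by_cases hYeq : Y = E
    · exact hX (hYeq ▸ h)
    rcases htri O Y E hYO.symm hYeq hOE with h' | h' | h'
    · exact hX (hsymm _ _ _ (hmid _ _ _ _ (hsymm _ _ _ h') (hsymm _ _ _ h)))
    · exact hY h'
    · exact hX (hsymm _ _ _ (hleft _ _ _ _ (hsymm _ _ _ h') (hsymm _ _ _ h)))
  have sameNeg : ∀ X Y, B X O E → B Y O E → ¬ B X O Y := by
    intro X Y hX hY h
    rcases htri X Y E (hne _ _ _ h).2.2 (hne _ _ _ hY).2.2 (hne _ _ _ hX).2.2 with h' | h' | h'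
    · exact hnot _ _ _ (hsymm _ _ _ hY) (hsymm _ _ _ (hleft _ _ _ _ h h'))
    · exact hnot _ _ _ (hsymm _ _ _ hX) (hsymm _ _ _ (hleft _ _ _ _ (hsymm _ _ _ h) h'))
    · exact hnot _ _ _ hY (hsymm _ _ _ (hleft _ _ _ _ hX h'))
  -- Negative points precede `O` and positive points follow it. On the positive side the point
  -- nearer to `O` comes first, on the negative side the farther one.
  let lt : T → T → Prop := fun X Y =>
    (B X O E ∧ ¬ B Y O E) ∨ (X = O ∧ Y ≠ O ∧ ¬ B Y O E) ∨
    (¬ B X O E ∧ ¬ B Y O E ∧ B O X Y) ∨ (B X O E ∧ B Y O E ∧ B X Y O)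
  have hltO : ∀ X, lt X O ↔ B X O E := by
    intro X
    grind
  have hOlt : ∀ X, lt O X ↔ X ≠ O ∧ ¬ B X O E := by
    intro X
    grind
  have lt_irrefl : ∀ X, ¬ lt X X := by
    intro X
    grind
  have lt_trans : ∀ X Y Z, lt X Y → lt Y Z → lt X Z := by
    intro X Y Z
    grind
  have lt_tri : ∀ X Y, X ≠ Y → lt X Y ∨ lt Y X := by
    intro X Y hXY
    by_cases hXO : X = O
    · subst hXO
      grind
    by_cases hYO : Y = O
    · subst hYO
      grind
    have := htri O X Y (Ne.symm hXO) hXY (Ne.symm hYO)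
    grind
  have lt_btw : ∀ X Y Z, lt X Y → lt Y Z → B X Y Z := by
    intro X Y Z
    grind
  let L : LinearOrder T :=
    { lt := lt
      le := fun X Y => X = Y ∨ lt X Y
      le_refl := fun X => Or.inl rfl
      le_trans := by
        rintro X Y Z (rfl | h) (rfl | h')
        · exact Or.inl rfl
        · exact Or.inr h'
        · exact Or.inr h
        · exact Or.inr (lt_trans _ _ _ h h')
      le_antisymm := by
        rintro X Y (h | h) (h' | h')
        · exact h
        · exact h
        · exact h'.symm
        · exact absurd (lt_trans _ _ _ h h') (lt_irrefl X)
      lt_iff_le_not_ge := by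
        intro X Y
        constructor
        · intro h
          refine ⟨Or.inr h, ?_⟩
          rintro (rfl | h')
          · exact lt_irrefl _ h
          · exact lt_irrefl X (lt_trans _ _ _ h h')
        · rintro ⟨rfl | h, h'⟩
          · exact absurd (Or.inl rfl) h'
          · exact h
      le_total := by
        intro X Y
        by_cases h : X = Y
        · exact Or.inl (Or.inl h)
        · exact (lt_tri X Y h).imp Or.inr Or.inr
      toDecidableLE := Classical.decRel _ }
  refine ⟨L, (hOlt E).2 ⟨hOE.symm, fun h => (hne _ _ _ h).2.2 rfl⟩, fun X Y Z => ⟨fun h => ?_, ?_⟩⟩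
  · change (lt X Y ∧ lt Y Z) ∨ (lt Z Y ∧ lt Y X)
    obtain ⟨h1, h2, h3⟩ := hne _ _ _ h
    have t1 := lt_tri X Y h1
    have t2 := lt_tri Y Z h2
    have t3 := lt_tri X Z h3
    grind
  · rintro (⟨h1, h2⟩ | ⟨h1, h2⟩)
    · exact lt_btw _ _ _ h1 h2
    · exact hsymm _ _ _ (lt_btw _ _ _ h1 h2)

/-! ### Codirected vectors and the order of the line -/

namespace GeomData

variable {P : Type u} {G : GeomData P}

/-- The linear order on the line `a` induces the betweenness relation of `G`. -/
def OrderCompatible (G : GeomData P) (a : Set P) [LinearOrder a] : Prop :=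
  ∀ X Y Z : a, G.Btw X Y Z ↔ (X < Y ∧ Y < Z) ∨ (Z < Y ∧ Y < X)

namespace IsAbsoluteGeometry

theorem exists_orderCompatible (hG : G.IsAbsoluteGeometry) {a : Set P} (ha : G.IsLine a) {O E : a}
    (hOE : O ≠ E) : ∃ _ : LinearOrder a, O < E ∧ G.OrderCompatible a := by
  refine exists_linearOrder_of_betweenness (fun X Y Z : a => G.Btw X Y Z) ?_ ?_ ?_ ?_ ?_ ?_ hOE
  · intro X Y Z h
    simpa [← Subtype.coe_inj] using hG.btw_ne h
  · exact fun X Y Z h => hG.btw_symm _ _ _ h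
  · exact fun X Y Z h => (hG.not_btw_of_btw h).1
  · exact fun X Y Z h1 h2 h3 => hG.btw_trichotomy ha X.2 Y.2 Z.2
      (Subtype.coe_ne_coe.2 h1) (Subtype.coe_ne_coe.2 h2) (Subtype.coe_ne_coe.2 h3)
  · exact fun X Y Z W h1 h2 => hG.btw_of_btw_of_btw_mid h1 h2
  · exact fun X Y Z W h1 h2 => hG.btw_of_btw_of_btw_left h1 h2

theorem exists_line_of_isMonotonicSeq (hG : G.IsAbsoluteGeometry) {n : ℕ} {S : ℕ → P}
    (hS : G.IsMonotonicSeq n S) : ∃ l, G.IsLine l ∧ ∀ i < n, S i ∈ l := by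
  obtain ⟨hn, hS⟩ := hS
  obtain ⟨l, hl, h0, h1⟩ := hG.exists_line (hG.btw_ne (hS 0 (by omega))).1
  refine ⟨l, hl, fun i => ?_⟩
  induction i using Nat.twoStepInduction with
  | zero => exact fun _ => h0
  | one => exact fun _ => h1
  | more i ih1 ih2 =>
    exact fun h => hG.btw_mem_right (hS i h) hl (ih1 (by omega)) (ih2 (by omega))

theorem mem_of_codirected (hG : G.IsAbsoluteGeometry) {a : Set P} (ha : G.IsLine a) {A B C D : P}
    (hC : C ∈ a) (hD : D ∈ a) (h : G.Codirected A B C D) : A ∈ a ∧ B ∈ a := by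
  obtain ⟨-, hCD, n, S, hS, i, j, k, l, hi, hj, hk, hl, rfl, rfl, rfl, rfl, -⟩ := h
  obtain ⟨m, hm, hSm⟩ := hG.exists_line_of_isMonotonicSeq hS
  have : a = m := hG.line_eq ha hm hCD hC hD (hSm k hk) (hSm l hl)
  exact ⟨this ▸ hSm i hi, this ▸ hSm j hj⟩

end IsAbsoluteGeometry

/-- The first triple fixes the direction, and each triple shares a pair with the next, which passes
the direction on. -/
theorem strictMono_or_strictAnti_of_btw {T : Type*} [LinearOrder T] {n : ℕ} {S : ℕ → T}
    (hS : ∀ i, i + 2 < n →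
      (S i < S (i + 1) ∧ S (i + 1) < S (i + 2)) ∨ (S (i + 2) < S (i + 1) ∧ S (i + 1) < S i))
    (hn : 3 ≤ n) :
    (∀ i j, i < j → j < n → S i < S j) ∨ (∀ i j, i < j → j < n → S j < S i) := by
  have aux : (∀ i, i + 1 < n → S i < S (i + 1)) ∨ (∀ i, i + 1 < n → S (i + 1) < S i) := by
    rcases hS 0 (by omega) with h | h
    · left
      intro i
      induction i with
      | zero => exact fun _ => h.1
      | succ i ih =>
        intro hi
        rcases hS i hi with h' | h'
        · exact h'.2
        · exact absurd h'.2 (ih (by omega)).asymm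
    · right
      intro i
      induction i with
      | zero => exact fun _ => h.2
      | succ i ih =>
        intro hi
        rcases hS i hi with h' | h'
        · exact absurd h'.1 (ih (by omega)).asymm
        · exact h'.1
  refine aux.imp (fun h i j hij => ?_) (fun h i j hij => ?_)
  · induction j, hij using Nat.le_induction with
    | base => exact h i
    | succ j _ ih => exact fun hj => (ih (by omega)).trans (h j hj)
  · induction j, hij using Nat.le_induction with
    | base => exact h i
    | succ j _ ih => exact fun hj => (h j hj).trans (ih (by omega))

theorem OrderCompatible.codirected_of_lt {a : Set P} [LinearOrder a] (h : G.OrderCompatible a)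
    (hG : G.IsAbsoluteGeometry) (ha : G.IsLine a) {X Y M N : a} (hXY : X < Y) (hMN : M < N) :
    G.Codirected X Y M N ∧ G.Codirected Y X N M := by
  classical
  -- A monotonic sequence needs three points; `F` supplies a third one when `X, Y, M, N` are only
  -- two. Sorting all of them gives the witness.
  obtain ⟨F, hF⟩ := hG.btw_extend X Y (Subtype.coe_ne_coe.2 hXY.ne)
  have hFa := hG.btw_mem_right hF ha X.2 Y.2
  lift F to a using hFa
  have hYF : Y < F := by
    rcases (h X Y F).1 hF with h' | h'
    · exact h'.2
    · exact absurd hXY h'.2.asymm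
  let s : Finset a := {X, Y, F, M, N}
  have hcard : 3 ≤ s.card := by
    have : ({X, Y, F} : Finset a).card = 3 :=
      Finset.card_eq_three.2 ⟨X, Y, F, hXY.ne, (hXY.trans hYF).ne, hYF.ne, rfl⟩
    rw [← this]
    exact Finset.card_le_card (by intro x; simp only [s, Finset.mem_insert, Finset.mem_singleton]; tauto)
  let e := s.orderIsoOfFin rfl
  let S : ℕ → P := fun i => if hi : i < s.card then ((e ⟨i, hi⟩ : s) : a) else (X : P)
  have hS : ∀ i (hi : i < s.card), S i = ((e ⟨i, hi⟩ : s) : a) := fun i hi => dif_pos hi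
  have hlt : ∀ i j (hi : i < s.card) (hj : j < s.card), i < j →
      ((e ⟨i, hi⟩ : s) : a) < ((e ⟨j, hj⟩ : s) : a) := fun i j hi hj hij =>
    e.strictMono (a := ⟨i, hi⟩) (b := ⟨j, hj⟩) hij
  have hmon : G.IsMonotonicSeq s.card S := by
    refine ⟨hcard, fun i hi => ?_⟩
    rw [hS i (by omega), hS (i + 1) (by omega), hS (i + 2) hi, h]
    exact Or.inl ⟨hlt _ _ _ _ (by omega), hlt _ _ _ _ (by omega)⟩
  have hidx : ∀ Z ∈ s, ∃ i, ∃ hi : i < s.card, ((e ⟨i, hi⟩ : s) : a) = Z := by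
    intro Z hZ
    obtain ⟨i, hi⟩ := e.surjective ⟨Z, hZ⟩
    exact ⟨i, i.2, congrArg Subtype.val hi⟩
  obtain ⟨i, hi, hX⟩ := hidx X (by simp [s])
  obtain ⟨j, hj, hY⟩ := hidx Y (by simp [s])
  obtain ⟨k, hk, hM⟩ := hidx M (by simp [s])
  obtain ⟨l, hl, hN⟩ := hidx N (by simp [s])
  have hij : i < j := by
    have : e ⟨i, hi⟩ < e ⟨j, hj⟩ := by rwa [← Subtype.coe_lt_coe, hX, hY]
    simpa using this
  have hkl : k < l := by
    have : e ⟨k, hk⟩ < e ⟨l, hl⟩ := by rwa [← Subtype.coe_lt_coe, hM, hN]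
    simpa using this
  refine ⟨⟨Subtype.coe_ne_coe.2 hXY.ne, Subtype.coe_ne_coe.2 hMN.ne, s.card, S, hmon,
    i, j, k, l, hi, hj, hk, hl, (hS i hi).trans (congrArg _ hX), (hS j hj).trans (congrArg _ hY),
    (hS k hk).trans (congrArg _ hM), (hS l hl).trans (congrArg _ hN), ?_⟩,
    ⟨Subtype.coe_ne_coe.2 hXY.ne', Subtype.coe_ne_coe.2 hMN.ne', s.card, S, hmon,
    j, i, l, k, hj, hi, hl, hk, (hS j hj).trans (congrArg _ hY), (hS i hi).trans (congrArg _ hX), (hS l hl).trans (congrArg _ hN),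
    (hS k hk).trans (congrArg _ hM), ?_⟩⟩
  · rw [sign_pos (by omega), sign_pos (by omega)]
  · rw [sign_neg (by omega), sign_neg (by omega)]

/-- A monotonic sequence is strictly increasing or strictly decreasing in the order of the line, so
comparing signs of index differences compares directions. -/
theorem OrderCompatible.codirected_iff {a : Set P} [LinearOrder a] (h : G.OrderCompatible a)
    (hG : G.IsAbsoluteGeometry) (ha : G.IsLine a) (X Y M N : a) :
    G.Codirected X Y M N ↔ (X < Y ∧ M < N) ∨ (Y < X ∧ N < M) := by
  constructor
  · rintro ⟨hXY, hMN, n, S, hS, i, j, k, l, hi, hj, hk, hl, hSi, hSj, hSk, hSl, hsign⟩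
    obtain ⟨m, hm, hSm⟩ := hG.exists_line_of_isMonotonicSeq hS
    obtain rfl : a = m :=
      hG.line_eq ha hm hXY X.2 Y.2 (hSi ▸ hSm i hi) (hSj ▸ hSm j hj)
    -- Indices from `n` on get the arbitrary value `S 0`.
    let T : ℕ → a := fun i => if hi : i < n then ⟨S i, hSm i hi⟩ else
      ⟨S 0, hSm 0 (by have := hS.1; omega)⟩
    have hT : ∀ i, i < n → (T i : P) = S i := fun i hi => by simp [T, hi]
    have hTS : ∀ {i} {Z : a}, i < n → S i = Z → T i = Z := fun hi hZ =>
      Subtype.ext ((hT _ hi).trans hZ)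
    obtain rfl := hTS hi hSi
    obtain rfl := hTS hj hSj
    obtain rfl := hTS hk hSk
    obtain rfl := hTS hl hSl
    have hne : ∀ {i j}, (T i : P) ≠ T j → i ≠ j := fun h h' => h (by rw [h'])
    have hsign' : (i < j ∧ k < l) ∨ (j < i ∧ l < k) := by
      rcases lt_or_gt_of_ne (hne hXY) with hij | hij <;>
        rcases lt_or_gt_of_ne (hne hMN) with hkl | hkl
      · exact Or.inl ⟨hij, hkl⟩
      · rw [sign_pos (by omega), sign_neg (by omega)] at hsign
        cases hsign
      · rw [sign_neg (by omega), sign_pos (by omega)] at hsign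
        cases hsign
      · exact Or.inr ⟨hij, hkl⟩
    have hmono := strictMono_or_strictAnti_of_btw (S := T) (n := n) (fun i hi => by
      rw [← h, hT i (by omega), hT (i + 1) (by omega), hT (i + 2) hi]
      exact hS.2 i hi) hS.1
    rcases hmono with hm | hm <;> rcases hsign' with ⟨h1, h2⟩ | ⟨h1, h2⟩
    · exact Or.inl ⟨hm _ _ h1 hj, hm _ _ h2 hl⟩
    · exact Or.inr ⟨hm _ _ h1 hi, hm _ _ h2 hk⟩
    · exact Or.inr ⟨hm _ _ h1 hj, hm _ _ h2 hl⟩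
    · exact Or.inl ⟨hm _ _ h1 hi, hm _ _ h2 hk⟩
  · rintro (⟨h1, h2⟩ | ⟨h1, h2⟩)
    · exact (h.codirected_of_lt hG ha h1 h2).1
    · exact (h.codirected_of_lt hG ha h1 h2).2

theorem OrderCompatible.prec_iff {a : Set P} [LinearOrder a] (h : G.OrderCompatible a)
    (hG : G.IsAbsoluteGeometry) (ha : G.IsLine a) {O E : a} (hOE : O < E) (X Y : a) :
    G.Prec O E X Y ↔ X < Y := by
  rw [Prec, h.codirected_iff hG ha]
  simp [hOE, hOE.asymm]

/-! ### Congruence of segments on a line -/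

theorem segment_comm (hG : G.IsAbsoluteGeometry) (A B : P) : G.segment A B = G.segment B A := by
  ext X
  have : G.Btw A X B ↔ G.Btw B X A := ⟨hG.btw_symm _ _ _, hG.btw_symm _ _ _⟩
  simp only [segment, Set.mem_union, Set.mem_singleton_iff, Set.mem_ofPred_eq, this]
  tauto

theorem SegCong.swap_left (hG : G.IsAbsoluteGeometry) {A B C D : P} (h : G.SegCong A B C D) :
    G.SegCong B A C D :=
  ⟨h.1.symm, h.2.1, segment_comm hG A B ▸ h.2.2⟩

theorem SegCong.swap_right (hG : G.IsAbsoluteGeometry) {A B C D : P} (h : G.SegCong A B C D) :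
    G.SegCong A B D C :=
  ⟨h.1, h.2.1.symm, segment_comm hG C D ▸ h.2.2⟩

theorem IsAbsoluteGeometry.codirected_refl (hG : G.IsAbsoluteGeometry) {A B : P} (h : A ≠ B) :
    G.Codirected A B A B := by
  obtain ⟨a, ha, hA, hB⟩ := hG.exists_line h
  obtain ⟨_, hlt, hc⟩ := hG.exists_orderCompatible ha (O := ⟨A, hA⟩) (E := ⟨B, hB⟩)
    (by simpa using h)
  exact (hc.codirected_of_lt hG ha hlt hlt).1

theorem IsAbsoluteGeometry.mem_ray (hG : G.IsAbsoluteGeometry) {A B : P} (h : A ≠ B) :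
    B ∈ G.ray A B :=
  Or.inr (hG.codirected_refl h)

/-- Laying `[CD]` off on the ray from `A` through `B` gives `B'` with `[AB] ≅ [CD] ≅ [AB']`, and
uniqueness of laying off forces `B' = B`. -/
theorem SegCong.symm (hG : G.IsAbsoluteGeometry) {A B C D : P} (h : G.SegCong A B C D) :
    G.SegCong C D A B := by
  obtain ⟨B', ⟨hB', hCB'⟩, -⟩ := hG.seg_construct C D A B h.2.1 h.1
  have := (hG.seg_construct A B A B h.1 h.1).unique ⟨hG.mem_ray h.1, hG.seg_refl A B h.1⟩
    ⟨hB', hG.seg_trans _ _ _ _ _ _ h hCB'⟩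
  exact this ▸ hCB'

/-- Segments laid off in the same direction from a point are equal if congruent. -/
theorem OrderCompatible.eq_of_segCong {a : Set P} [LinearOrder a] (h : G.OrderCompatible a)
    (hG : G.IsAbsoluteGeometry) (ha : G.IsLine a) {Z V W : a}
    (hV : (Z < V ∧ Z < W) ∨ (V < Z ∧ W < Z)) (hcong : G.SegCong Z V Z W) : V = W := by
  have hW : (W : P) ∈ G.ray Z V := Or.inr <| (h.codirected_iff hG ha _ _ _ _).2 (by tauto)
  exact Subtype.ext <| (hG.seg_construct Z V Z V hcong.1 hcong.1).unique
    ⟨hG.mem_ray hcong.1, hG.seg_refl _ _ hcong.1⟩ ⟨hW, hcong⟩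

theorem OrderCompatible.exists_segCong {a : Set P} [LinearOrder a] (h : G.OrderCompatible a)
    (hG : G.IsAbsoluteGeometry) (ha : G.IsLine a) {A B : P} (hAB : A ≠ B) {Z V : a}
    (hZV : Z ≠ V) : ∃ W : a, ((Z < V ∧ Z < W) ∨ (V < Z ∧ W < Z)) ∧ G.SegCong A B Z W := by
  obtain ⟨W, ⟨hW, hc⟩, -⟩ := hG.seg_construct A B Z V hAB (Subtype.coe_ne_coe.2 hZV)
  rcases hW with hW | hW
  · exact absurd hW.symm hc.2.1
  · have hWa := (hG.mem_of_codirected ha Z.2 V.2 hW).2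
    lift W to a using hWa
    have hW' := (h.codirected_iff hG ha _ _ _ _).1 hW
    exact ⟨W, by tauto, hc⟩

end GeomData

/-! ### Equality and addition of vectors on a line -/

/-- A relation of equality of vectors on a linear order is additive once it is so for vectors of
the positive direction. -/
theorem vector_add_of_sorted {T : Type*} [LinearOrder T] {R : T → T → T → T → Prop}
    (hex : ∀ X Y Z, ∃ W, R X Y Z W) (huniq : ∀ X Y Z W W', R X Y Z W → R X Y Z W' → W = W')
    (hrev : ∀ X Y Z W, R X Y Z W → R Y X W Z) (hdeg : ∀ X Z W, R X X Z W → Z = W)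
    (hsort : ∀ X Y Z X' Y' Z', X < Y → Y < Z → R X Y X' Y' → R Y Z Y' Z' → R X Z X' Z')
    {X Y Z X' Y' Z' : T} (h₁ : R X Y X' Y') (h₂ : R Y Z Y' Z') : R X Z X' Z' := by
  -- `flip` and `swap` generate all permutations of a triple, so additivity need only be known for
  -- sorted and degenerate triples.
  let Tri : T → T → T → Prop := fun X Y Z =>
    ∀ X' Y' Z', R X Y X' Y' → R Y Z Y' Z' → R X Z X' Z'
  have flip : ∀ {X Y Z}, Tri X Y Z → Tri Z Y X := fun h X' Y' Z' h1 h2 =>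
    hrev _ _ _ _ (h _ _ _ (hrev _ _ _ _ h2) (hrev _ _ _ _ h1))
  have swap : ∀ {X Y Z}, Tri X Y Z → Tri X Z Y := by
    intro X Y Z h X' Z' Y' h1 h2
    -- Copy `XY` and `YZ` from `X'`; by uniqueness the copy ends at `Z'`, and then its middle point
    -- is `Y'`.
    obtain ⟨Y'', hY''⟩ := hex X Y X'
    obtain ⟨Z'', hZ''⟩ := hex Y Z Y''
    obtain rfl := huniq _ _ _ _ _ (h _ _ _ hY'' hZ'') h1
    obtain rfl := huniq _ _ _ _ _ (hrev _ _ _ _ hZ'') h2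
    exact hY''
  have deg : ∀ X Y, Tri X X Y := by
    intro X Y X' Y' Z' h1 h2
    obtain rfl := hdeg _ _ _ h1
    exact h2
  have sorted : ∀ {X Y Z}, X < Y → Y < Z → Tri X Y Z := fun h1 h2 _ _ _ => hsort _ _ _ _ _ _ h1 h2
  suffices Tri X Y Z from this _ _ _ h₁ h₂
  rcases lt_trichotomy X Y with h | rfl | h
  · rcases lt_trichotomy Y Z with h' | rfl | h'
    · exact sorted h h'
    · exact flip (deg _ _)
    · rcases lt_trichotomy X Z with h'' | rfl | h''
      · exact swap (sorted h'' h')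
      · exact swap (deg _ _)
      · exact flip (swap (sorted h'' h))
  · exact deg _ _
  · rcases lt_trichotomy Y Z with h' | rfl | h'
    · rcases lt_trichotomy X Z with h'' | rfl | h''
      · exact swap (flip (swap (sorted h h'')))
      · exact swap (deg _ _)
      · exact swap (flip (sorted h' h''))
    · exact flip (deg _ _)
    · exact flip (sorted h' h)

namespace GeomData

variable {P : Type u} {G : GeomData P}

/-- Equality of the vectors `XY` and `ZW` on a line with a compatible order. -/
def VecEq (G : GeomData P) {a : Set P} [LinearOrder a] (X Y Z W : a) : Prop :=
  (X = Y ∧ Z = W) ∨ (X < Y ∧ Z < W ∧ G.SegCong X Y Z W) ∨ (Y < X ∧ W < Z ∧ G.SegCong X Y Z W)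

namespace VecEq

variable {a : Set P} [LinearOrder a] {X Y Z W U V : a}

theorem refl (hG : G.IsAbsoluteGeometry) (X Y : a) : G.VecEq X Y X Y := by
  rcases lt_trichotomy X Y with h | h | h
  · exact Or.inr (Or.inl ⟨h, h, hG.seg_refl _ _ (Subtype.coe_ne_coe.2 h.ne)⟩)
  · exact Or.inl ⟨h, h⟩
  · exact Or.inr (Or.inr ⟨h, h, hG.seg_refl _ _ (Subtype.coe_ne_coe.2 h.ne')⟩)

theorem symm (hG : G.IsAbsoluteGeometry) (h : G.VecEq X Y Z W) : G.VecEq Z W X Y := by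
  rcases h with ⟨h1, h2⟩ | ⟨h1, h2, h3⟩ | ⟨h1, h2, h3⟩
  · exact Or.inl ⟨h2, h1⟩
  · exact Or.inr (Or.inl ⟨h2, h1, h3.symm hG⟩)
  · exact Or.inr (Or.inr ⟨h2, h1, h3.symm hG⟩)

theorem trans (hG : G.IsAbsoluteGeometry) (h : G.VecEq X Y Z W) (h' : G.VecEq Z W U V) :
    G.VecEq X Y U V := by
  have htr := hG.seg_trans X Y Z W U V
  unfold VecEq at *
  grind

theorem reverse (hG : G.IsAbsoluteGeometry) (h : G.VecEq X Y Z W) : G.VecEq Y X W Z := by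
  rcases h with ⟨h1, h2⟩ | ⟨h1, h2, h3⟩ | ⟨h1, h2, h3⟩
  · exact Or.inl ⟨h1.symm, h2.symm⟩
  · exact Or.inr (Or.inr ⟨h1, h2, (h3.swap_left hG).swap_right hG⟩)
  · exact Or.inr (Or.inl ⟨h1, h2, (h3.swap_left hG).swap_right hG⟩)

theorem eq_of_self (h : G.VecEq X X Z W) : Z = W := by
  rcases h with ⟨h1, h2⟩ | ⟨h1, h2, h3⟩ | ⟨h1, h2, h3⟩
  · exact h2
  · exact absurd h1 (lt_irrefl _)
  · exact absurd h1 (lt_irrefl _)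

theorem lt_iff (h : G.VecEq X Y Z W) : X < Y ↔ Z < W := by
  rcases h with ⟨rfl, rfl⟩ | ⟨h1, h2, h3⟩ | ⟨h1, h2, h3⟩
  · simp
  · simp [h1, h2]
  · simp [h1.asymm, h2.asymm]

end VecEq

theorem OrderCompatible.btw_of_lt {a : Set P} [LinearOrder a] (h : G.OrderCompatible a) {X Y Z : a}
    (h1 : X < Y) (h2 : Y < Z) : G.Btw X Y Z :=
  (h X Y Z).2 (Or.inl ⟨h1, h2⟩)

namespace OrderCompatible

variable {a : Set P} [LinearOrder a] (h : G.OrderCompatible a) (hG : G.IsAbsoluteGeometry)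
  (ha : G.IsLine a)
include h hG ha

theorem exists_btw {X Z : a} (hXZ : X < Z) : ∃ Y, X < Y ∧ Y < Z := by
  obtain ⟨Y, hY⟩ := hG.exists_btw (Subtype.coe_ne_coe.2 hXZ.ne)
  lift Y to a using hG.btw_mem_mid hY ha X.2 Z.2
  rcases (h X Y Z).1 hY with h' | h'
  · exact ⟨Y, h'⟩
  · exact absurd (h'.1.trans h'.2) hXZ.asymm

/-- Every point of a line has points of the line on both sides. -/
theorem exists_lt_lt (X : a) : ∃ Y Z, Y < X ∧ X < Z := by
  obtain ⟨V, hV⟩ : ∃ V : a, V ≠ X := by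
    obtain ⟨A, hA, B, hB, hAB⟩ := hG.line_two_points a ha
    by_contra! hall
    have := (hall ⟨A, hA⟩).trans (hall ⟨B, hB⟩).symm
    exact hAB (congrArg Subtype.val this)
  obtain ⟨W, hW⟩ := hG.btw_extend V X (Subtype.coe_ne_coe.2 hV)
  lift W to a using hG.btw_mem_right hW ha V.2 X.2
  rcases (h V X W).1 hW with h' | h'
  · exact ⟨V, W, h'⟩
  · exact ⟨W, V, h'⟩

theorem exists_vecEq (X Y Z : a) : ∃ W, G.VecEq X Y Z W := by
  obtain ⟨V, V', hV, hV'⟩ := h.exists_lt_lt hG ha Z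
  rcases lt_trichotomy X Y with hXY | rfl | hXY
  · obtain ⟨W, hW, hc⟩ := h.exists_segCong hG ha (Subtype.coe_ne_coe.2 hXY.ne) hV'.ne
    refine ⟨W, Or.inr (Or.inl ⟨hXY, ?_, hc⟩)⟩
    rcases hW with hW | hW
    · exact hW.2
    · exact absurd hV' hW.1.asymm
  · exact ⟨Z, Or.inl ⟨rfl, rfl⟩⟩
  · obtain ⟨W, hW, hc⟩ := h.exists_segCong hG ha (Subtype.coe_ne_coe.2 hXY.ne') hV.ne'
    refine ⟨W, Or.inr (Or.inr ⟨hXY, ?_, hc⟩)⟩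
    rcases hW with hW | hW
    · exact absurd hV hW.1.asymm
    · exact hW.2

theorem vecEq_unique {X Y Z W W' : a} (h₁ : G.VecEq X Y Z W) (h₂ : G.VecEq X Y Z W') :
    W = W' := by
  have h₃ := (h₁.symm hG).trans hG h₂
  rcases h₃ with ⟨h3, h4⟩ | ⟨h3, h4, h5⟩ | ⟨h3, h4, h5⟩
  · exact h3.symm.trans h4
  · exact h.eq_of_segCong hG ha (Or.inl ⟨h3, h4⟩) h5
  · exact h.eq_of_segCong hG ha (Or.inr ⟨h3, h4⟩) h5

theorem vecEq_add {X Y Z X' Y' Z' : a} (h₁ : G.VecEq X Y X' Y') (h₂ : G.VecEq Y Z Y' Z') :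
    G.VecEq X Z X' Z' := by
  refine vector_add_of_sorted (R := G.VecEq) (h.exists_vecEq hG ha)
    (fun _ _ _ _ _ => h.vecEq_unique hG ha) (fun _ _ _ _ => VecEq.reverse hG)
    (fun _ _ _ => VecEq.eq_of_self) ?_ h₁ h₂
  intro X Y Z X' Y' Z' hXY hYZ h1 h2
  have hXY' := h1.lt_iff.1 hXY
  have hYZ' := h2.lt_iff.1 hYZ
  have c1 : G.SegCong X Y X' Y' := by
    rcases h1 with h1 | h1 | h1
    exacts [absurd h1.1 hXY.ne, h1.2.2, h1.2.2]
  have c2 : G.SegCong Y Z Y' Z' := by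
    rcases h2 with h2 | h2 | h2
    exacts [absurd h2.1 hYZ.ne, h2.2.2, h2.2.2]
  exact Or.inr (Or.inl ⟨hXY.trans hYZ, hXY'.trans hYZ', hG.seg_add _ _ _ _ _ _
    (h.btw_of_lt hXY hYZ) (h.btw_of_lt hXY' hYZ') c1 c2⟩)

/-- Vectors added in the opposite order give the same sum. Congruence ignores direction, so
`seg_add` also compares an increasing triple with a decreasing one; the relation used is that `X'Y'`
is opposite to `XY`. -/
theorem vecEq_add_reversed {X Y Z X' Y' Z' : a} (h₁ : G.VecEq Y X X' Y')
    (h₂ : G.VecEq Z Y Y' Z') : G.VecEq Z X X' Z' := by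
  refine vector_add_of_sorted (R := fun X Y Z W => G.VecEq Y X Z W)
    (fun X Y => h.exists_vecEq hG ha Y X) (fun _ _ _ _ _ => h.vecEq_unique hG ha)
    (fun _ _ _ _ => VecEq.reverse hG) (fun _ _ _ => VecEq.eq_of_self) ?_ h₁ h₂
  intro X Y Z X' Y' Z' hXY hYZ h1 h2
  have hXY' := (h1.reverse hG).lt_iff.1 hXY
  have hYZ' := (h2.reverse hG).lt_iff.1 hYZ
  have c1 : G.SegCong Y X X' Y' := by
    rcases h1 with h1 | h1 | h1
    exacts [absurd h1.1 hXY.ne', h1.2.2, h1.2.2]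
  have c2 : G.SegCong Z Y Y' Z' := by
    rcases h2 with h2 | h2 | h2
    exacts [absurd h2.1 hYZ.ne', h2.2.2, h2.2.2]
  exact Or.inr (Or.inr ⟨hXY.trans hYZ, hYZ'.trans hXY', SegCong.swap_left hG <|
    hG.seg_add _ _ _ _ _ _ (h.btw_of_lt hXY hYZ)
      (hG.btw_symm _ _ _ (h.btw_of_lt hYZ' hXY')) (c1.swap_left hG) (c2.swap_left hG)⟩)

/-- The parallelogram rule, which amounts to commutativity of the addition of vectors. -/
theorem vecEq_parallelogram {X Y Z W : a} (h₁ : G.VecEq X Y Z W) : G.VecEq X Z Y W :=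
  -- `XZ = XY + YZ` and `YW = YZ + ZW` have equal summands in opposite orders.
  h.vecEq_add_reversed hG ha (VecEq.refl hG Y Z) h₁

end OrderCompatible
end GeomData

/-! ### The ordered group of a line and its real coordinate -/

namespace GeomData

variable {P : Type u} {G : GeomData P}

/-- `φ` is the coordinate on the line `a` measured from `O` with the unit segment `OE`. -/
structure IsRuler (G : GeomData P) {a : Set P} (O E : a) (φ : a ≃ ℝ) : Prop where
  zero : φ O = 0
  one : φ E = 1
  prec_iff : ∀ X Y : a, G.Prec O E X Y ↔ φ X < φ Y
  btw_iff : ∀ X Y Z : a, G.Btw X Y Z ↔ (φ X < φ Y ∧ φ Y < φ Z) ∨ (φ Z < φ Y ∧ φ Y < φ X)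
  segCong_iff : ∀ X Y Z W : a, G.SegCong X Y Z W ↔ X ≠ Y ∧ |φ Y - φ X| = |φ W - φ Z|

namespace OrderCompatible

variable {a : Set P} [LinearOrder a] (h : G.OrderCompatible a) (hG : G.IsAbsoluteGeometry)
  (ha : G.IsLine a)
include h hG ha

/-- The points of a line with an origin form an ordered group under addition of position vectors. -/
theorem exists_addCommGroup (O : a) : ∃ _ : AddCommGroup a, (0 : a) = O ∧ IsOrderedAddMonoid a ∧
    ∀ X Y Z W : a, G.VecEq X Y Z W ↔ Y - X = W - Z := by
  -- `X + Y` is the end of the vector `OX` laid off from `Y`.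
  choose add hadd using h.exists_vecEq hG ha O
  have uniq : ∀ {X Y Z W W' : a}, G.VecEq X Y Z W → G.VecEq X Y Z W' → W = W' :=
    fun h₁ h₂ => h.vecEq_unique hG ha h₁ h₂
  have comm : ∀ X Y, add X Y = add Y X := fun X Y =>
    uniq (h.vecEq_parallelogram hG ha (hadd X Y)) (hadd Y X) |>.symm ▸ rfl
  have zero_add : ∀ X, add O X = X := fun X => (hadd O X).eq_of_self.symm
  have assoc : ∀ X Y Z, add (add X Y) Z = add X (add Y Z) := by
    intro X Y Z
    have h1 : G.VecEq Y (add X Y) (add Y Z) (add X (add Y Z)) :=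
      ((hadd X Y).symm hG).trans hG (hadd X (add Y Z))
    exact uniq (hadd (add X Y) Z) (h.vecEq_add hG ha (hadd Y Z) h1)
  choose neg hneg using fun X => h.exists_vecEq hG ha X O O
  have neg_add : ∀ X, add (neg X) X = O := fun X =>
    uniq (hadd (neg X) X) ((hneg X).symm hG)
  let _ : Add a := ⟨add⟩
  let _ : Zero a := ⟨O⟩
  let _ : Neg a := ⟨neg⟩
  let inst : AddCommGroup a :=
    { add_assoc := assoc
      zero_add := zero_add
      add_zero := fun X => (comm X O).trans (zero_add X)
      nsmul := nsmulRec
      zsmul := zsmulRec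
      neg_add_cancel := neg_add
      add_comm := comm }
  have hadd' : ∀ X Y : a, G.VecEq O X Y (X + Y) := hadd
  have hvec : ∀ X Y Z W : a, G.VecEq X Y Z W ↔ Y - X = W - Z := by
    intro X Y Z W
    have h1 : G.VecEq O (Y - X) X Y := by simpa using hadd' (Y - X) X
    have h2 : G.VecEq O (W - Z) Z W := by simpa using hadd' (W - Z) Z
    constructor
    · intro h3
      have h4 := uniq (h1.trans hG h3) (hadd' (Y - X) Z)
      rw [h4, add_sub_cancel_right]
    · intro h3
      exact (h1.symm hG).trans hG (h3 ▸ h2)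
  refine ⟨inst, rfl, { add_le_add_left := fun X Y hXY Z => ?_ }, hvec⟩
  have h1 : G.VecEq X Y (X + Z) (Y + Z) := (hvec _ _ _ _).2 (by abel)
  have h2 := (h1.reverse hG).lt_iff
  exact not_lt.1 fun h3 => hXY.not_gt (h2.2 h3)

theorem denselyOrdered : DenselyOrdered a := ⟨fun _ _ => h.exists_btw hG ha⟩

theorem mem_segment_iff {A B : a} (hAB : A < B) (X : P) :
    X ∈ G.segment A B ↔ ∃ Z : a, (Z : P) = X ∧ A ≤ Z ∧ Z ≤ B := by
  constructor
  · rintro ((rfl | rfl) | hX)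
    · exact ⟨A, rfl, le_rfl, hAB.le⟩
    · exact ⟨B, rfl, hAB.le, le_rfl⟩
    · lift X to a using hG.btw_mem_mid hX ha A.2 B.2
      rcases (h A X B).1 hX with h' | h'
      · exact ⟨X, rfl, h'.1.le, h'.2.le⟩
      · exact absurd (h'.1.trans h'.2) hAB.asymm
  · rintro ⟨Z, rfl, h1, h2⟩
    rcases h1.eq_or_lt with rfl | h1
    · exact Or.inl (Or.inl rfl)
    rcases h2.eq_or_lt with rfl | h2
    · exact Or.inl (Or.inr rfl)
    exact Or.inr (h.btw_of_lt h1 h2)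

/-- Archimedes' axiom provides a chain that may lie on any line of space, so it has to be carried
over to `a` by congruence. -/
theorem archimedean [AddCommGroup a] [IsOrderedAddMonoid a]
    (hvec : ∀ X Y Z W : a, G.VecEq X Y Z W ↔ Y - X = W - Z) : Archimedean a := by
  have hcong : ∀ {X Y Z W : a}, X < Y → Y - X = W - Z → Z < W ∧ G.SegCong X Y Z W := by
    intro X Y Z W hXY heq
    rcases (hvec _ _ _ _).2 heq with h' | h' | h'
    exacts [absurd h'.1 hXY.ne, h'.2, absurd hXY h'.1.asymm]
  refine ⟨fun x y hy => ?_⟩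
  rcases le_or_gt x 0 with hx | hx
  · exact ⟨0, by simpa using hx⟩
  obtain ⟨n, hn, C, D, ⟨S, rfl, rfl, hS, hSb⟩, F, hF, hxF⟩ :=
    hG.archimedes (0 : a) x (0 : a) y (Subtype.coe_ne_coe.2 hx.ne) (Subtype.coe_ne_coe.2 hy.ne)
  have hstep : ∀ k : ℕ, k • y < (k + 1) • y ∧ G.SegCong (0 : a) y (k • y : a) ((k + 1) • y : a) :=
    fun k => hcong hy (by rw [succ_nsmul]; abel)
  -- The first `k + 1` links of the chain add up to a segment congruent to `[0, (k + 1) • y]`.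
  have hmul : ∀ k, k < n → G.SegCong (S 0) (S (k + 1)) (0 : a) ((k + 1) • y : a) ∧
      (k + 1 < n → G.Btw (S 0) (S (k + 1)) (S (k + 2))) := by
    intro k
    induction k with
    | zero => exact fun hk => ⟨by simpa using hS 0 hk, fun h1 => hSb 0 h1⟩
    | succ k ih =>
      intro hk
      obtain ⟨ih1, ih2⟩ := ih (by omega)
      have hb := ih2 hk
      refine ⟨?_, fun h1 => hG.btw_of_btw_of_btw_mid hb (hSb (k + 1) h1)⟩
      exact hG.seg_add _ _ _ _ _ _ hb
        (h.btw_of_lt (nsmul_pos hy (by omega)) (hstep (k + 1)).1) ih1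
        (hG.seg_trans _ _ _ _ _ _ (hS (k + 1) hk) (hstep (k + 1)).2)
  obtain ⟨m, rfl⟩ : ∃ m, n = m + 1 := ⟨n - 1, by omega⟩
  refine ⟨m + 1, ?_⟩
  obtain ⟨hm, -⟩ := hmul m (by omega)
  obtain ⟨V, V', -, hV⟩ := h.exists_lt_lt hG ha x
  -- Laying the rest of the chain, from `F` on, off beyond `x` ends at `w`, which must be `(m + 1) •
  -- y`.
  obtain ⟨w, hw, hFw⟩ := h.exists_segCong hG ha (hG.btw_ne hF).2.1 hV.ne
  have hxw : x < w := by
    rcases hw with hw | hw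
    · exact hw.2
    · exact absurd hV hw.1.asymm
  have h0w := hG.seg_add _ _ _ _ _ _ hF (h.btw_of_lt hx hxw) (hxF.symm hG) hFw
  have := h.eq_of_segCong hG ha (Or.inl ⟨nsmul_pos hy m.succ_ne_zero, hx.trans hxw⟩)
    (hG.seg_trans _ _ _ _ _ _ (hm.symm hG) h0w)
  exact (this ▸ hxw).le

end OrderCompatible

/-- A line is isometric to the real line; the unit segment may be prescribed. -/
theorem IsAbsoluteGeometry.exists_ruler (hG : G.IsAbsoluteGeometry) {a : Set P} (ha : G.IsLine a)
    {O E : a} (hOE : O ≠ E) : ∃ φ : a ≃ ℝ, G.IsRuler O E φ := by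
  obtain ⟨_, hlt, h⟩ := hG.exists_orderCompatible ha hOE
  obtain ⟨_, h0, _, hvec⟩ := h.exists_addCommGroup hG ha O
  have := h.archimedean hG ha hvec
  have := h.denselyOrdered hG ha
  obtain ⟨f, hf⟩ := Archimedean.exists_orderAddMonoidHom_real_injective a
  have hmono : StrictMono f := (OrderHomClass.mono f).strictMono_of_injective hf
  have hE : 0 < f E := by
    rw [← map_zero f]
    exact hmono (h0 ▸ hlt)
  -- A subgroup of `ℝ` other than zero is dense unless it has a least positive element, which
  -- density of the order on `a` excludes.
  have hdense : Dense (Set.range f) := by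
    have hd := AddSubgroup.dense_of_no_min (f : a →+ ℝ).range
      (fun hbot => hE.ne' (AddSubgroup.mem_bot.1 (hbot ▸ ⟨E, rfl⟩ : f E ∈ (⊥ : AddSubgroup ℝ)))) (by
        rintro ⟨_, ⟨⟨g, rfl⟩, hg⟩, hmin⟩
        have hg' : (0 : a) < g := by
          rw [← hmono.lt_iff_lt, map_zero]
          exact hg
        obtain ⟨k, hk0, hk⟩ := exists_between hg'
        have hk1 : 0 < f k := by
          rw [← map_zero f]
          exact hmono hk0
        exact (hmono hk).not_ge (hmin ⟨⟨k, rfl⟩, hk1⟩))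
    simpa using hd
  have hsurj : Function.Surjective f := by
    intro r
    -- The endpoints are taken with images between `r ∓ 1/(n+1)` and `r ∓ 1/(n+2)`: these disjoint
    -- ranges make the segments nested and shrink them to `r`.
    have hpos : ∀ n : ℕ, (1 : ℝ) / (n + 1 + 1) < 1 / (n + 1) := fun n =>
      one_div_lt_one_div_of_lt (by positivity) (by linarith)
    have hA : ∀ n : ℕ, ∃ X : a, r - 1 / (n + 1) < f X ∧ f X < r - 1 / (n + 1 + 1) := by
      intro n
      obtain ⟨_, ⟨X, rfl⟩, hX⟩ := hdense.exists_between (sub_lt_sub_left (hpos n) r)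
      exact ⟨X, hX⟩
    have hB : ∀ n : ℕ, ∃ X : a, r + 1 / (n + 1 + 1) < f X ∧ f X < r + 1 / (n + 1) := by
      intro n
      obtain ⟨_, ⟨X, rfl⟩, hX⟩ := hdense.exists_between (add_lt_add_right (hpos n) r)
      exact ⟨X, hX⟩
    choose A hA1 hA2 using hA
    choose B hB1 hB2 using hB
    have hAB : ∀ n, A n < B n := fun n => by
      rw [← hmono.lt_iff_lt]
      have : (0 : ℝ) < 1 / (n + 1 + 1) := by positivity
      linarith [hA2 n, hB1 n]
    have hAA : ∀ n, A n ≤ A (n + 1) := fun n => by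
      rw [← hmono.le_iff_le]
      have := hA1 (n + 1)
      push_cast at this
      linarith [hA2 n]
    have hBB : ∀ n, B (n + 1) ≤ B n := fun n => by
      rw [← hmono.le_iff_le]
      have := hB2 (n + 1)
      push_cast at this
      linarith [hB1 n]
    obtain ⟨X, hX⟩ := hG.cantor a (fun n => A n) (fun n => B n) ha
      (fun n => ⟨(A n).2, (B n).2, Subtype.coe_ne_coe.2 (hAB n).ne⟩) (fun n X hX => by
        rw [h.mem_segment_iff hG ha (hAB _)] at hX ⊢
        obtain ⟨Z, rfl, h1, h2⟩ := hX
        exact ⟨Z, rfl, (hAA n).trans h1, h2.trans (hBB n)⟩)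
    obtain ⟨Z, rfl, -⟩ := (h.mem_segment_iff hG ha (hAB 0) X).1 (hX 0)
    have hZ : ∀ n, A n ≤ Z ∧ Z ≤ B n := fun n => by
      obtain ⟨Z', hZ', h1⟩ := (h.mem_segment_iff hG ha (hAB n) Z).1 (hX n)
      rwa [Subtype.ext hZ'] at h1
    refine ⟨Z, le_antisymm (le_of_forall_pos_lt_add fun ε hε => ?_)
      (le_of_forall_pos_lt_add fun ε hε => ?_)⟩
    all_goals
      obtain ⟨n, hn⟩ := exists_nat_one_div_lt hε
      have h1 := hmono.monotone (hZ n).1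
      have h2 := hmono.monotone (hZ n).2
      linarith [hA1 n, hB2 n]
  -- Dividing by `f E` makes `[OE]` the unit.
  let φ : a ≃ ℝ := Equiv.ofBijective (fun X => f X / f E)
    ⟨fun X Y hXY => hf ((div_left_inj' hE.ne').1 hXY), fun r => by
      obtain ⟨X, hX⟩ := hsurj (r * f E)
      exact ⟨X, by simp only [hX]; field_simp⟩⟩
  have hφ : ∀ X, φ X = f X / f E := fun X => rfl
  have hφlt : ∀ X Y, φ X < φ Y ↔ X < Y := fun X Y => by
    rw [hφ, hφ, div_lt_div_iff_of_pos_right hE, hmono.lt_iff_lt]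
  have hφvec : ∀ X Y Z W, G.VecEq X Y Z W ↔ φ Y - φ X = φ W - φ Z := fun X Y Z W => by
    rw [hvec, hφ, hφ, hφ, hφ, ← sub_div, ← sub_div, div_left_inj' hE.ne', ← map_sub, ← map_sub,
      hf.eq_iff]
  refine ⟨φ, by rw [hφ, ← h0, map_zero, zero_div], div_self hE.ne', fun X Y => ?_, fun X Y Z => ?_,
    fun X Y Z W => ?_⟩
  · rw [h.prec_iff hG ha hlt, hφlt]
  · rw [h X Y Z, hφlt, hφlt, hφlt, hφlt]
  -- Congruent segments are equal vectors after possibly reversing one of them, hence the two cases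
  -- of `abs_eq_abs`.
  · have key : ∀ {X Y Z W : a}, G.SegCong X Y Z W → (X < Y ↔ Z < W) → G.VecEq X Y Z W := by
      intro X Y Z W hc hiff
      have h1 := hc.1
      have h2 := hc.2.1
      rcases lt_or_gt_of_ne (Subtype.coe_ne_coe.1 h1) with h3 | h3
      · exact Or.inr (Or.inl ⟨h3, hiff.1 h3, hc⟩)
      · rcases lt_or_gt_of_ne (Subtype.coe_ne_coe.1 h2) with h4 | h4
        · exact absurd (hiff.2 h4) h3.asymm
        · exact Or.inr (Or.inr ⟨h3, h4, hc⟩)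
    have key' : ∀ {X Y Z W : a}, X ≠ Y → G.VecEq X Y Z W → G.SegCong X Y Z W := by
      rintro X Y Z W hne (h1 | h1 | h1)
      exacts [absurd h1.1 hne, h1.2.2, h1.2.2]
    rw [abs_eq_abs]
    constructor
    · intro hc
      refine ⟨Subtype.coe_ne_coe.1 hc.1, ?_⟩
      by_cases hiff : X < Y ↔ Z < W
      · exact Or.inl ((hφvec _ _ _ _).1 (key hc hiff))
      · right
        rw [neg_sub]
        refine (hφvec _ _ _ _).1 (key (hc.swap_right hG) ?_)
        have h2 := Subtype.coe_ne_coe.1 hc.2.1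
        constructor
        · intro h3
          exact (lt_or_gt_of_ne h2).resolve_left fun h4 => hiff (iff_of_true h3 h4)
        · intro h3
          by_contra h4
          exact hiff (iff_of_false h4 h3.asymm)
    · rintro ⟨hne, h1 | h1⟩
      · exact key' hne ((hφvec _ _ _ _).2 h1)
      · rw [neg_sub] at h1
        exact (key' hne ((hφvec _ _ _ _).2 h1)).swap_right hG

end GeomData

/-! ### Binary-rational numbers -/

theorem coe_binRat (k : ℤ) (m : ℕ) : (binRat k m : ℝ) = k / 2 ^ m := rfl

theorem exists_eq_binRat (r : binaryRationals) : ∃ k m, r = binRat k m := by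
  obtain ⟨_, k, m, rfl⟩ := r
  exact ⟨k, m, rfl⟩

theorem binRat_two_mul (k : ℤ) (m : ℕ) : binRat (2 * k) (m + 1) = binRat k m := by
  ext
  simp only [coe_binRat]
  push_cast
  field_simp
  ring

theorem exists_binRat_between {x y : ℝ} (h : x < y) :
    ∃ r : binaryRationals, x < r ∧ (r : ℝ) < y := by
  obtain ⟨m, hm⟩ := exists_pow_lt_of_lt_one (sub_pos.2 h) (by norm_num : (1 / 2 : ℝ) < 1)
  have h2 : (0 : ℝ) < 2 ^ m := by positivity
  have hm' : 1 < (y - x) * 2 ^ m := by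
    rwa [one_div_pow, div_lt_iff₀ h2] at hm
  -- The least multiple of `2⁻ᵐ` above `x`; it stays below `y` because `2⁻ᵐ < y - x`.
  refine ⟨binRat (⌊x * 2 ^ m⌋ + 1) m, ?_, ?_⟩
  · rw [coe_binRat, lt_div_iff₀ h2]
    push_cast
    exact Int.lt_floor_add_one _
  · rw [coe_binRat, div_lt_iff₀ h2]
    have := Int.floor_le (x * 2 ^ m)
    push_cast
    linarith

/-- A monotone function on the real line that fixes the binary-rational numbers is the identity. -/
theorem StrictMono.eq_self_of_binRat {f : ℝ → ℝ} (hf : StrictMono f)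
    (hfix : ∀ r : binaryRationals, f r = r) (x : ℝ) : f x = x := by
  rcases lt_trichotomy (f x) x with h | h | h
  · obtain ⟨r, h1, h2⟩ := exists_binRat_between h
    have := hf h2
    rw [hfix] at this
    exact absurd this h1.asymm
  · exact h
  · obtain ⟨r, h1, h2⟩ := exists_binRat_between h
    have := hf h1
    rw [hfix] at this
    exact absurd this h2.asymm

/-! ### Translations, centers and gauges in coordinates -/

namespace GeomData.IsRuler

variable {P : Type u} {G : GeomData P} {a : Set P} {O E : a} {φ : a ≃ ℝ} (hφ : G.IsRuler O E φ)
include hφ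

theorem isTranslation {X Y : a} : G.IsTranslation a O E X Y
    (fun U => φ.symm (φ U + (φ Y - φ X))) := by
  refine ⟨fun U V hUV => ?_, fun U V hUV => ?_, fun U hU => ?_⟩
  · rw [hφ.segCong_iff]
    simp [hUV]
  · rw [hφ.prec_iff] at hUV ⊢
    simpa using hUV
  · rw [Subtype.ext hU]
    simp

/-- The image of `U` keeps its distance from the image `Y` of `X`, and precedence tells on which
side of `Y` it lies. -/
theorem apply_translation {X Y : a} {f : a → a} (hf : G.IsTranslation a O E X Y f) (U : a) :
    φ (f U) = φ U + (φ Y - φ X) := by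
  obtain ⟨hcong, hprec, hXY⟩ := hf
  have hX : f X = Y := Subtype.ext (hXY X rfl)
  by_cases hUX : U = X
  · rw [hUX, hX]
    ring
  have h1 := ((hφ.segCong_iff _ _ _ _).1 (hcong U X hUX)).2
  rw [hX] at h1
  rcases lt_or_gt_of_ne (φ.injective.ne hUX) with h2 | h2
  · have h3 := (hφ.prec_iff _ _).1 (hprec U X ((hφ.prec_iff _ _).2 h2))
    rw [hX] at h3
    rw [abs_of_pos (by linarith), abs_of_pos (by linarith)] at h1
    linarith
  · have h3 := (hφ.prec_iff _ _).1 (hprec X U ((hφ.prec_iff _ _).2 h2))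
    rw [hX] at h3
    rw [abs_of_neg (by linarith), abs_of_neg (by linarith)] at h1
    linarith

theorem isCenter_iff {X Y M : a} :
    G.IsCenter X Y M ↔ X ≠ Y ∧ φ M = (φ X + φ Y) / 2 := by
  rw [IsCenter, hφ.btw_iff, hφ.segCong_iff]
  constructor
  · rintro ⟨h1 | h1, -, h2⟩
    · rw [abs_of_pos (by linarith), abs_of_pos (by linarith)] at h2
      exact ⟨fun h => (h1.1.trans h1.2).ne (h ▸ rfl), by linarith⟩
    · rw [abs_of_neg (by linarith), abs_of_neg (by linarith)] at h2
      exact ⟨fun h => (h1.1.trans h1.2).ne (h ▸ rfl), by linarith⟩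
  · rintro ⟨hne, hM⟩
    have hcong : |φ M - φ X| = |φ Y - φ M| := by
      rw [hM]
      congr 1
      ring
    rcases lt_or_gt_of_ne (φ.injective.ne hne) with h1 | h1
    · refine ⟨Or.inl ⟨by linarith, by linarith⟩, fun h => ?_, hcong⟩
      rw [h] at h1 hM
      linarith
    · refine ⟨Or.inr ⟨by linarith, by linarith⟩, fun h => ?_, hcong⟩
      rw [h] at h1 hM
      linarith

theorem isBinaryGauge : G.IsBinaryGauge a O E (fun r => φ.symm r) where
  zero := by
    rw [Subtype.coe_inj, Equiv.symm_apply_eq, hφ.zero]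
    simp [coe_binRat]
  one := by
    rw [Subtype.coe_inj, Equiv.symm_apply_eq, hφ.one]
    simp [coe_binRat]
  forward := ⟨_, hφ.isTranslation, fun n => by simp [coe_binRat, hφ.zero, hφ.one]⟩
  backward := ⟨_, hφ.isTranslation, fun n => by
    simp [coe_binRat, hφ.zero, hφ.one, add_comm]⟩
  bisect m k := by
    rw [hφ.isCenter_iff]
    have h2 : (0 : ℝ) < 2 ^ m := by positivity
    constructor
    · rw [φ.symm.injective.ne_iff, coe_binRat, coe_binRat]
      push_cast
      rw [Ne, div_left_inj' h2.ne']
      simp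
    · simp only [Equiv.apply_symm_apply, coe_binRat]
      push_cast
      field_simp
      ring

/-- The points of a binary gauge have the binary-rational numbers as their coordinates. -/
theorem apply_gauge {A : binaryRationals → a} (hA : G.IsBinaryGauge a O E A)
    (r : binaryRationals) : φ (A r) = r := by
  obtain ⟨k, m, rfl⟩ := exists_eq_binRat r
  have h0 : φ (A (binRat 0 0)) = 0 := by rw [Subtype.ext hA.zero, hφ.zero]
  obtain ⟨p, hp, hpA⟩ := hA.forward
  obtain ⟨q, hq, hqA⟩ := hA.backward
  have hpos : ∀ n : ℕ, φ (A (binRat n 0)) = n := by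
    intro n
    induction n with
    | zero => exact_mod_cast h0
    | succ n ih =>
      have := hφ.apply_translation hp (A (binRat n 0))
      rw [← hpA, ih, hφ.zero, hφ.one] at this
      push_cast
      rw [this]
      ring
  have hneg : ∀ n : ℕ, φ (A (binRat (-n) 0)) = -n := by
    intro n
    induction n with
    | zero => simpa using h0
    | succ n ih =>
      have := hφ.apply_translation hq (A (binRat (-n) 0))
      rw [← hqA, ih, hφ.zero, hφ.one] at this
      push_cast
      rw [this]
      ring
  -- An even numerator reduces to level `m`; an odd one is a midpoint of two points of level `m`.
  induction m generalizing k with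
  | zero =>
    obtain ⟨n, rfl | rfl⟩ := k.eq_nat_or_neg
    · simpa [coe_binRat] using hpos n
    · simpa [coe_binRat] using hneg n
  | succ m ih =>
    obtain ⟨j, rfl | rfl⟩ := k.even_or_odd'
    · rw [binRat_two_mul, ih]
    · rw [(hφ.isCenter_iff.1 (hA.bisect m j)).2, ih, ih]
      simp only [coe_binRat]
      push_cast
      field_simp
      ring

end GeomData.IsRuler

/-! ### The coordinate theorem -/

theorem theorem6p1 {P : Type u} (G : GeomData P) (hG : G.IsAbsoluteGeometry)
    (a : Set P) (ha : G.IsLine a) (O E : P) (hO : O ∈ a) (hE : E ∈ a) (hOE : O ≠ E) :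
    (∃! A : binaryRationals → a, G.IsBinaryGauge a O E A) ∧
    ∀ A : binaryRationals → a, G.IsBinaryGauge a O E A →
      (∀ p q : binaryRationals, p < q → G.Prec O E (A p) (A q)) ∧
      ∃! Aext : ℝ → a,
        (∀ r : binaryRationals, Aext r = A r) ∧
        Function.Bijective Aext ∧
        ∀ ξ η : ℝ, ξ < η → G.Prec O E (Aext ξ) (Aext η) := by
  lift O to a using hO
  lift E to a using hE
  obtain ⟨φ, hφ⟩ := hG.exists_ruler ha (Subtype.coe_ne_coe.1 hOE)
  refine ⟨⟨_, hφ.isBinaryGauge, fun A hA => ?_⟩, fun A hA => ⟨fun p q hpq => ?_, φ.symm,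
    ⟨fun r => ?_, φ.symm.bijective, fun ξ η hξη => ?_⟩, ?_⟩⟩
  · funext r
    rw [Equiv.eq_symm_apply, hφ.apply_gauge hA]
  · rwa [hφ.prec_iff, hφ.apply_gauge hA, hφ.apply_gauge hA]
  · rw [Equiv.symm_apply_eq, hφ.apply_gauge hA]
  · rwa [hφ.prec_iff, Equiv.apply_symm_apply, Equiv.apply_symm_apply]
  · rintro B ⟨hBA, -, hB⟩
    have hmono : StrictMono (φ ∘ B) := fun ξ η hξη => (hφ.prec_iff _ _).1 (hB ξ η hξη)
    funext x
    rw [Equiv.eq_symm_apply]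
    exact hmono.eq_self_of_binRat (fun r => by rw [Function.comp, hBA, hφ.apply_gauge hA]) x
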